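/- Conventions. Fix a finite set $G$ of elementary quantum gates, i.e. finitely many unitaries, each acting on some number of qubits (for instance a universal gate set). A quantum distinguisher on $n$ qubits appends some ancilla qubits in state $|0\rangle$ to its input, applies a sequence of gates of $G$, each to a chosen tuple of distinct qubits, measures the first qubit in the computational basis and outputs the result; its size is the number of gates, and $\Pr[A(\rho)=1]$ is the probability that it outputs $1$. States $\rho,\sigma$ are $(s,\varepsilon)$-indistinguishable if $|\Pr[A(\rho)=1]-\Pr[A(\sigma)=1]|\le\varepsilon$ for all distinguishers $A$ of size at most $s$. Logarithms are to base $2$. For states on $n$ qubits put $D_\infty(\rho\|\sigma)=\inf\{\lambda\in\mathbb R:\rho\le 2^\lambda\sigma\}$ (with $\inf\emptyset=\infty$) and $H_{\min}(\rho)=n-D_\infty(\rho\|2^{-n}I)$; $\sigma$ is $\delta$-dense in $\rho$ if $\sigma\le\frac1\delta\rho$. Say $D^{\mathsf{HILL\text{-}1}}_{s,\varepsilon}(\rho\|\sigma)\le\lambda$ if some $\rho'$ that is $(s,\varepsilon)$-indistinguishable from $\rho$ has $D_\infty(\rho'\|\sigma)\le\lambda$, and $D^{\mathsf{HILL\text{-}2}}_{s,\varepsilon}(\rho\|\sigma)\le\lambda$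 if some $\sigma'$ that is $(s,\varepsilon)$-indistinguishable from $\sigma$ has $D_\infty(\rho\|\sigma')\le\lambda$; $D^{\mathsf{HILL\text{-}}i}_{s,\varepsilon}(\rho\|\sigma)$ is the infimum of all such $\lambda$. Two ensembles of states, indexed by a security parameter $\kappa\in\mathbb N$, are computationally indistinguishable if every family of distinguishers of size polynomial in $\kappa$ has advantage negligible in $\kappa$. For ensembles and $\lambda:\mathbb N\to[-\infty,\infty]$, $D^{\mathsf{HILL\text{-}1}}(\rho\|\sigma)\le\lambda$ means that there is an ensemble $\rho'$ computationally indistinguishable from $\rho$ with $D_\infty(\rho'_\kappa\|\sigma_\kappa)\le\lambda(\kappa)$ for all $\kappa$; $D^{\mathsf{HILL\text{-}2}}(\rho\|\sigma)\le\lambda$ means that there is an ensemble $\sigma'$ computationally indistinguishable from $\sigma$ with $D_\infty(\rho_\kappa\|\sigma'_\kappa)\le\lambda(\kappa)$ for all $\kappa$. Theorem. Let $G$ be a finite gate set. (1) (Impossibility of a quantum dense model theorem.) There are constants $C>0$ and $c\in\mathbb N$ depending only on $G$ such that for every integer $s\ge1$, all $\varepsilon>0$ and $0<\delta<1-4\varepsilon$,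 and all integers $m_1,m_2>C\log(s/\varepsilon)$, there are states $\rho^X,\rho^Y,\rho^Z$ on $m_1+m_2$ qubits such that $H_{\min}(\rho^X)=m_1$, $H_{\min}(\rho^Y)=m_2$, $\rho^Z$ is $\delta$-dense in $\rho^X$, the states $\rho^X$ and $\rho^Y$ are $(s,\varepsilon)$-indistinguishable, and for every state $\rho^M$ that is $\delta$-dense in $\rho^Y$ there is a distinguisher $A$ of size at most $c$ with $|\Pr[A(\rho^M)=1]-\Pr[A(\rho^Z)=1]|>\varepsilon$. (2) (Separation of HILL relative min-entropies.) There are constants $C>0$ and $c\in\mathbb N$ depending only on $G$ such that for every integer $s\ge1$, all $\varepsilon>0$ and $0<\delta<1-4\varepsilon$, and every integer $n>C\log(s/\varepsilon)$, there are $n$-qubit states $\rho,\sigma$ with $D^{\mathsf{HILL\text{-}2}}_{s,\varepsilon}(\rho\|\sigma)<\log(1/\delta)$ and $D^{\mathsf{HILL\text{-}1}}_{c,(1-\delta)/4}(\rho\|\sigma)=\infty$. (3) (Asymptotic separation.) For every $n:\mathbb N\to\mathbb N$ with $n(\kappa)=\omega(\log\kappa)$ there are ensembles $\rho=(\rho_\kappa)$,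 $\sigma=(\sigma_\kappa)$ of $n(\kappa)$-qubit states with $D^{\mathsf{HILL\text{-}2}}(\rho\|\sigma)\le1$ and $D^{\mathsf{HILL\text{-}1}}(\rho\|\sigma)=\infty$, the latter in the sense that $D^{\mathsf{HILL\text{-}1}}(\rho\|\sigma)\le\lambda$ fails for every $\lambda$ with $\lambda(\kappa)<\infty$ for infinitely many $\kappa$. -/

import Mathlib

open scoped Asymptotics ComplexOrder

noncomputable section

/-- The computational basis of the `n`-qubit space `ℂ^(2^n) = (ℂ²)^{⊗ n}`: all `n`-bit strings. -/
abbrev QBasis (n : ℕ) : Type := Fin n → Bool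

/-- Linear operators on the `n`-qubit space, written in the computational basis. -/
abbrev QOp (n : ℕ) : Type := Matrix (QBasis n) (QBasis n) ℂ

/-- An `n`-qubit (mixed) quantum state: a density operator. -/
structure QState (n : ℕ) where
  op : QOp n
  posSemidef : op.PosSemidef
  trace_eq_one : op.trace = 1

/-- The maximally mixed state `2^{-n} I`. -/
def maximallyMixed (n : ℕ) : QState n where
  op := ((2 : ℝ) ^ n)⁻¹ • (1 : QOp n)
  posSemidef := Matrix.PosSemidef.one.smul (by positivity)
  trace_eq_one := by
    rw [Matrix.trace_smul, Matrix.trace_one]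
    simp [QBasis]

/-! ### Circuits and distinguishers -/

/-- A finite set of elementary quantum gates: finitely many unitaries, the `g`-th of them
acting on `arity g` qubits. (A universal gate set is a special case.) -/
structure GateSet where
  card : ℕ
  arity : Fin card → ℕ
  mat : ∀ g, QOp (arity g)
  unitary : ∀ g, mat g ∈ Matrix.unitaryGroup (QBasis (arity g)) ℂ

/-- A gate of `G` together with the distinct wires (out of `w`) to which it is applied. -/
structure PlacedGate (G : GateSet) (w : ℕ) where
  gate : Fin G.card
  wires : Fin (G.arity gate) ↪ Fin w

open Classical in
/-- The operator on `w` qubits that applies the gate on the chosen wires and is the identity on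
all other wires. -/
def PlacedGate.toOp {G : GateSet} {w : ℕ} (p : PlacedGate G w) : QOp w :=
  Matrix.of fun x y =>
    if ∀ i, i ∉ Set.range p.wires → x i = y i then
      G.mat p.gate (x ∘ p.wires) (y ∘ p.wires)
    else 0

/-- A quantum distinguisher with `n` input qubits over the gate set `G`: a number of ancilla
qubits and a sequence of placed gates on the `n + ancillas` qubits of the work space (input
qubits first). -/
structure Distinguisher (G : GateSet) (n : ℕ) where
  ancillas : ℕ
  workspace_pos : 0 < n + ancillas
  gates : List (PlacedGate G (n + ancillas))

namespace Distinguisher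

variable {G : GateSet} {n : ℕ}

/-- The size of a distinguisher is its number of gates. -/
def size (A : Distinguisher G n) : ℕ := A.gates.length

/-- The unitary `U₁ U₂ ⋯ U_s` of the circuit. -/
def unitaryOp (A : Distinguisher G n) : QOp (n + A.ancillas) :=
  (A.gates.map PlacedGate.toOp).prod

open Classical in
/-- The initial state `ρ ⊗ |0⋯0⟩⟨0⋯0|` of the work space. -/
def initialOp (A : Distinguisher G n) (ρ : QState n) : QOp (n + A.ancillas) :=
  Matrix.of fun x y =>
    if ∀ j : Fin A.ancillas, x (Fin.natAdd n j) = false ∧ y (Fin.natAdd n j) = false then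
      ρ.op (fun i => x (Fin.castAdd A.ancillas i)) (fun i => y (Fin.castAdd A.ancillas i))
    else 0

/-- The projector `|1⟩⟨1| ⊗ I` onto the outcome `1` of the first qubit. -/
def outcomeOne (A : Distinguisher G n) : QOp (n + A.ancillas) :=
  Matrix.diagonal fun x => if x ⟨0, A.workspace_pos⟩ = true then 1 else 0

/-- The probability that the distinguisher outputs `1` on input `ρ`, when all ancillas are
initialized to `|0⟩`, and the first qubit is measured after the circuit. -/
def prob (A : Distinguisher G n) (ρ : QState n) : ℝ :=
  (A.outcomeOne * (A.unitaryOp * A.initialOp ρ * A.unitaryOp.conjTranspose)).trace.re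

/-- The advantage of the distinguisher on `ρ` and `σ`. -/
def advantage (A : Distinguisher G n) (ρ σ : QState n) : ℝ := |A.prob ρ - A.prob σ|

end Distinguisher

/-- `(s, ε)`-indistinguishability: no distinguisher of size at most `s` has advantage more
than `ε`. -/
def Indist (G : GateSet) {n : ℕ} (s : ℕ) (ε : ℝ) (ρ σ : QState n) : Prop :=
  ∀ A : Distinguisher G n, A.size ≤ s → A.advantage ρ σ ≤ ε

/-! ### Density and relative min-entropies -/

/-- `σ` is `δ`-dense in `ρ`: `σ ≤ (1/δ) ρ` in the Loewner order. -/
def DenseIn {n : ℕ} (δ : ℝ) (σ ρ : QState n) : Prop :=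
  ((1 / δ) • ρ.op - σ.op).PosSemidef

/-- Quantum relative min-entropy `D_∞(ρ‖σ) = inf {λ ∈ ℝ : ρ ≤ 2^λ σ}`, which is `⊤` if there is
no such `λ`. -/
def relMinEntropy {n : ℕ} (ρ σ : QState n) : EReal :=
  sInf ((fun l : ℝ => (l : EReal)) '' {l : ℝ | ((2 : ℝ) ^ l • σ.op - ρ.op).PosSemidef})

/-- Quantum min-entropy `H_min(ρ) = n - D_∞(ρ ‖ 2^{-n} I)`. -/
def minEntropy {n : ℕ} (ρ : QState n) : EReal :=
  (n : EReal) - relMinEntropy ρ (maximallyMixed n)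

/-- `D^{HILL-1}_{s,ε}(ρ‖σ) ≤ l`. -/
def HILL1LE (G : GateSet) {n : ℕ} (s : ℕ) (ε : ℝ) (ρ σ : QState n) (l : EReal) : Prop :=
  ∃ ρ' : QState n, Indist G s ε ρ' ρ ∧ relMinEntropy ρ' σ ≤ l

/-- `D^{HILL-2}_{s,ε}(ρ‖σ) ≤ l`. -/
def HILL2LE (G : GateSet) {n : ℕ} (s : ℕ) (ε : ℝ) (ρ σ : QState n) (l : EReal) : Prop :=
  ∃ σ' : QState n, Indist G s ε σ' σ ∧ relMinEntropy ρ σ' ≤ l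

/-- `D^{HILL-1}_{s,ε}(ρ‖σ)`, the least upper bound allowed by `HILL1LE`. -/
def hill1 (G : GateSet) {n : ℕ} (s : ℕ) (ε : ℝ) (ρ σ : QState n) : EReal :=
  sInf {l : EReal | HILL1LE G s ε ρ σ l}

/-- `D^{HILL-2}_{s,ε}(ρ‖σ)`, the least upper bound allowed by `HILL2LE`. -/
def hill2 (G : GateSet) {n : ℕ} (s : ℕ) (ε : ℝ) (ρ σ : QState n) : EReal :=
  sInf {l : EReal | HILL2LE G s ε ρ σ l}

/-! ### Asymptotic versions, for ensembles indexed by a security parameter -/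

/-- Computational indistinguishability of two ensembles: every family of distinguishers of size
polynomial in the security parameter `κ` (nonuniform, with ancillas `|0⟩`) has negligible
advantage. -/
def CompIndist (G : GateSet) {n : ℕ → ℕ} (ρ σ : ∀ κ, QState (n κ)) : Prop :=
  ∀ (p : Polynomial ℕ) (A : ∀ κ, Distinguisher G (n κ)),
    (∀ κ, (A κ).size ≤ p.eval κ) →
      Asymptotics.SuperpolynomialDecay Filter.atTop (fun κ : ℕ => (κ : ℝ))
        (fun κ => (A κ).advantage (ρ κ) (σ κ))

/-- `D^{HILL-1}(ρ‖σ) ≤ l` for ensembles. -/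
def AsympHILL1LE (G : GateSet) {n : ℕ → ℕ} (ρ σ : ∀ κ, QState (n κ)) (l : ℕ → EReal) : Prop :=
  ∃ ρ' : ∀ κ, QState (n κ), CompIndist G ρ' ρ ∧ ∀ κ, relMinEntropy (ρ' κ) (σ κ) ≤ l κ

/-- `D^{HILL-2}(ρ‖σ) ≤ l` for ensembles. -/
def AsympHILL2LE (G : GateSet) {n : ℕ → ℕ} (ρ σ : ∀ κ, QState (n κ)) (l : ℕ → EReal) : Prop :=
  ∃ σ' : ∀ κ, QState (n κ), CompIndist G σ' σ ∧ ∀ κ, relMinEntropy (ρ κ) (σ' κ) ≤ l κ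

end

/-!
Let `n = k + 1`. For signs `w : QBasis k → Bool` the vectors `ψ_j = (|0,j⟩ ± |1,j⟩) / √2` are
orthonormal, and the compression of the observable `|1⟩⟨1| ⊗ I` to their span is exactly `1/2`
(`signMatrix_compress_firstQubitOne`). A state that is dominated by a multiple of a mixture `σ` of
the `ψ_j` is supported on that span, so its first qubit is unbiased, whatever the multiple is
(`trace_mul_of_dominated`). The circuit without gates therefore tells all such states from a state
with a biased first qubit. This is the quantum ingredient: classically, conditioning a distribution
on the first bit costs only a constant factor in density.

On the other hand, against the maximally mixed state, which is the average over the signs, the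
advantage of a circuit on the uniform mixture of the `ψ_j` is a Rademacher sum with `2 ^ k` terms.
Its tails are exponentially small in `2 ^ k ε ^ 2` (`exists_signs`). Circuits of size `s` touch at
most `s * G.maxArity` ancillas, so there are only finitely many of them up to the names of the
ancillas (`exists_finite_distinguishers`), and once `n > C log (s / ε)` a union bound gives signs
that fool all of them (`exists_signState_indist`, `exists_const_union_bound`).

With `σ` this mixture, the maximally mixed state in the role of `σ'`, and `ρ` the product of a
biased qubit and a maximally mixed state, this separates the two HILL relative min-entropies, both
for fixed parameters (`hill_separation`) and for ensembles, where `s` and `1 / ε` grow like a small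
power of `2 ^ n` (`exists_ensemble_term`, `compIndist_of_indist`).

For the dense model statement the min-entropies `m₁` and `m₂` are prescribed. They are worst-case
quantities, so they can be adjusted by giving one index a larger weight: this changes all
acceptance probabilities by at most `2 * 2 ^ (-m) ≤ ε / 4` and keeps the span of the `ψ_j`
(`exists_weights`, `abs_prob_mixture_sub_le`, `not_denseModel`).
-/

noncomputable section

/-! ### Operators acting on part of the wires -/

open Classical in
/-- The operator on `w'` qubits that acts as `M` on the wires in the range of `e` and as the
identity on all other wires. -/
def liftOp {w w' : ℕ} (e : Fin w ↪ Fin w') (M : QOp w) : QOp w' :=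
  Matrix.of fun x y => if ∀ i, i ∉ Set.range e → x i = y i then M (x ∘ e) (y ∘ e) else 0

open Classical in
/-- The projector onto the basis states that vanish on all wires outside the range of `e`. -/
def zeroOff {w w' : ℕ} (e : Fin w ↪ Fin w') : QOp w' :=
  Matrix.diagonal fun x => if ∀ i, i ∉ Set.range e → x i = false then 1 else 0

section liftOp

variable {w w' w'' : ℕ} (e : Fin w ↪ Fin w')

open Classical in
/-- The bit strings that agree with `x` off the range of `e` are parametrized by their
restriction to that range. -/
lemma sum_agree {R : Type*} [AddCommMonoid R] (x : QBasis w') (F : QBasis w → R) :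
    (∑ z : QBasis w', if ∀ i, i ∉ Set.range e → x i = z i then F (z ∘ e) else 0) = ∑ u, F u := by
  rw [← Finset.sum_filter]
  refine Finset.sum_nbij' (fun z => z ∘ e) (fun u => Function.extend e u x) ?_ ?_ ?_ ?_ ?_
  · simp
  · intro u _
    simp only [Finset.mem_filter, Finset.mem_univ, true_and]
    intro i hi
    rw [Function.extend_apply' _ _ _ (by simpa using hi)]
  · intro z hz
    simp only [Finset.mem_filter, Finset.mem_univ, true_and] at hz
    funext i
    by_cases hi : i ∈ Set.range e
    · obtain ⟨j, rfl⟩ := hi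
      rw [e.injective.extend_apply]; rfl
    · rw [Function.extend_apply' _ _ _ (by simpa using hi), hz i hi]
  · intro u _
    funext j
    exact e.injective.extend_apply _ _ _
  · simp

lemma liftOp_mul (M N : QOp w) : liftOp e (M * N) = liftOp e M * liftOp e N := by
  classical
  ext x y
  simp only [liftOp, Matrix.mul_apply, Matrix.of_apply]
  by_cases h : ∀ i, i ∉ Set.range e → x i = y i
  · rw [if_pos h, ← sum_agree e x]
    refine Finset.sum_congr rfl fun z _ => ?_
    by_cases hz : ∀ i, i ∉ Set.range e → x i = z i
    · have hz' : ∀ i, i ∉ Set.range e → z i = y i := fun i hi => (hz i hi).symm.trans (h i hi)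
      rw [if_pos hz, if_pos hz, if_pos hz']
    · rw [if_neg hz, if_neg hz, zero_mul]
  · rw [if_neg h]
    refine (Finset.sum_eq_zero fun z _ => ?_).symm
    by_cases hz : ∀ i, i ∉ Set.range e → x i = z i
    · rw [if_neg fun hz' : ∀ i, i ∉ Set.range e → z i = y i =>
        h fun i hi => (hz i hi).trans (hz' i hi), mul_zero]
    · rw [if_neg hz, zero_mul]

lemma liftOp_diagonal (d : QBasis w → ℂ) :
    liftOp e (Matrix.diagonal d) = Matrix.diagonal fun x => d (x ∘ e) := by
  classical
  ext x y
  simp only [liftOp, Matrix.of_apply, Matrix.diagonal_apply]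
  by_cases hxy : x = y
  · simp [hxy]
  · rw [if_neg hxy]
    split_ifs with h h'
    · refine absurd (funext fun i => ?_) hxy
      by_cases hi : i ∈ Set.range e
      · obtain ⟨j, rfl⟩ := hi
        exact congrFun h' j
      · exact h i hi
    · rfl
    · rfl

lemma liftOp_one : liftOp e (1 : QOp w) = 1 := by
  rw [← Matrix.diagonal_one, liftOp_diagonal, ← Matrix.diagonal_one]

lemma liftOp_conjTranspose (M : QOp w) : liftOp e M.conjTranspose = (liftOp e M).conjTranspose := by
  classical
  ext x y
  simp only [liftOp, Matrix.conjTranspose_apply, Matrix.of_apply]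
  by_cases h : ∀ i, i ∉ Set.range e → x i = y i
  · rw [if_pos h, if_pos fun i hi => (h i hi).symm]
  · rw [if_neg h, if_neg fun h' : ∀ i, i ∉ Set.range e → y i = x i => h fun i hi => (h' i hi).symm,
      star_zero]

lemma liftOp_add (M N : QOp w) : liftOp e (M + N) = liftOp e M + liftOp e N := by
  ext x y
  simp only [liftOp, Matrix.of_apply, Matrix.add_apply]
  split_ifs <;> simp

lemma liftOp_smul (c : ℝ) (M : QOp w) : liftOp e (c • M) = c • liftOp e M := by
  ext x y
  simp only [liftOp, Matrix.of_apply, Matrix.smul_apply]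
  split_ifs <;> simp

lemma forall_notMem_range_trans (f : Fin w' ↪ Fin w'') (q : Fin w'' → Prop) :
    (∀ i, i ∉ Set.range (e.trans f) → q i) ↔
      (∀ i, i ∉ Set.range f → q i) ∧ ∀ j, j ∉ Set.range e → q (f j) := by
  constructor
  · refine fun h => ⟨fun i hi => h i ?_, fun j hj => h (f j) ?_⟩
    · rintro ⟨j, rfl⟩
      exact hi ⟨e j, rfl⟩
    · rintro ⟨l, hl⟩
      exact hj ⟨l, f.injective hl⟩
  · rintro ⟨h, h'⟩ i hi
    by_cases hf : i ∈ Set.range f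
    · obtain ⟨j, rfl⟩ := hf
      refine h' j ?_
      rintro ⟨l, rfl⟩
      exact hi ⟨l, rfl⟩
    · exact h i hf

lemma liftOp_liftOp (f : Fin w' ↪ Fin w'') (M : QOp w) :
    liftOp f (liftOp e M) = liftOp (e.trans f) M := by
  ext x y
  simp only [liftOp, Matrix.of_apply, Function.comp_apply,
    forall_notMem_range_trans e f fun i => x i = y i]
  rw [ite_and]
  rfl

lemma zeroOff_trans (f : Fin w' ↪ Fin w'') :
    zeroOff (e.trans f) = liftOp f (zeroOff e) * zeroOff f := by
  classical
  rw [zeroOff, zeroOff, zeroOff, liftOp_diagonal, Matrix.diagonal_mul_diagonal]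
  refine congrArg _ (funext fun x => ?_)
  simp only [forall_notMem_range_trans e f fun i => x i = false, Function.comp_apply]
  split_ifs <;> simp_all

lemma liftOp_mul_zeroOff_comm (M : QOp w) : liftOp e M * zeroOff e = zeroOff e * liftOp e M := by
  classical
  ext x y
  simp only [zeroOff, Matrix.mul_diagonal, Matrix.diagonal_mul, liftOp, Matrix.of_apply]
  by_cases h : ∀ i, i ∉ Set.range e → x i = y i
  · have : (∀ i, i ∉ Set.range e → x i = false) ↔ ∀ i, i ∉ Set.range e → y i = false :=
      forall_congr' fun i => imp_congr_right fun hi => by rw [h i hi]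
    simp only [this]
    rw [mul_comm]
  · rw [if_neg h, zero_mul, mul_zero]

lemma zeroOff_mul_self : zeroOff e * zeroOff e = zeroOff e := by
  rw [zeroOff, Matrix.diagonal_mul_diagonal]
  refine congrArg _ (funext fun x => ?_)
  split_ifs <;> simp

lemma zeroOff_conjTranspose : (zeroOff e).conjTranspose = zeroOff e := by
  rw [zeroOff, Matrix.diagonal_conjTranspose]
  refine congrArg _ (funext fun x => ?_)
  simp only [Pi.star_apply]
  split_ifs <;> simp

lemma trace_liftOp_mul_zeroOff (M : QOp w) : (liftOp e M * zeroOff e).trace = M.trace := by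
  classical
  rw [Matrix.trace, Matrix.trace, ← sum_agree e (fun _ => false) fun u => M.diag u]
  refine Finset.sum_congr rfl fun x _ => ?_
  simp only [Matrix.diag_apply, zeroOff, Matrix.mul_diagonal, liftOp, Matrix.of_apply]
  simp only [eq_comm (a := false), mul_ite, mul_one, mul_zero]
  simp

open scoped MatrixOrder in
lemma liftOp_posSemidef {M : QOp w} (hM : M.PosSemidef) : (liftOp e M).PosSemidef := by
  obtain ⟨B, rfl⟩ := CStarAlgebra.nonneg_iff_eq_star_mul_self.1 hM.nonneg
  rw [Matrix.star_eq_conjTranspose, liftOp_mul, liftOp_conjTranspose]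
  exact Matrix.posSemidef_conjTranspose_mul_self _

lemma liftOp_mem_unitaryGroup {M : QOp w} (hM : M ∈ Matrix.unitaryGroup (QBasis w) ℂ) :
    liftOp e M ∈ Matrix.unitaryGroup (QBasis w') ℂ := by
  rw [Matrix.mem_unitaryGroup_iff, Matrix.star_eq_conjTranspose] at hM ⊢
  rw [← liftOp_conjTranspose, ← liftOp_mul, hM, liftOp_one]

end liftOp

/-! ### Acceptance probabilities -/

namespace Distinguisher

variable {G : GateSet} {n : ℕ} (A : Distinguisher G n)

/-- The ancillas are the wires outside the range of `Fin.castAddEmb`. -/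
lemma initialOp_eq (ρ : QState n) :
    A.initialOp ρ =
      liftOp (Fin.castAddEmb A.ancillas) ρ.op * zeroOff (Fin.castAddEmb A.ancillas) := by
  classical
  have key : ∀ q : Fin (n + A.ancillas) → Prop,
      (∀ i, i ∉ Set.range (Fin.castAddEmb (n := n) A.ancillas) → q i) ↔
        ∀ j : Fin A.ancillas, q (Fin.natAdd n j) := by
    intro q
    constructor
    · refine fun h j => h _ ?_
      rintro ⟨i, hi⟩
      have := congrArg Fin.val hi
      have := i.2
      simp at *
      omega
    · intro h i hi
      induction i using Fin.addCases with
      | left i => exact absurd ⟨i, rfl⟩ hi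
      | right j => exact h j
  ext x y
  simp only [initialOp, zeroOff, Matrix.mul_diagonal, liftOp, Matrix.of_apply,
    key fun i => x i = y i, key fun i => y i = false]
  by_cases hy : ∀ j : Fin A.ancillas, y (Fin.natAdd n j) = false
  · simp only [hy, and_true]
    simp
    rfl
  · rw [if_neg fun h => hy fun j => (h j).2, if_neg hy, mul_zero]

/-- The probability of the outcome `1`, as a linear functional of the input operator. -/
def acceptance : QOp n →ₗ[ℝ] ℝ where
  toFun M := (A.outcomeOne * (A.unitaryOp *
    (liftOp (Fin.castAddEmb A.ancillas) M * zeroOff (Fin.castAddEmb A.ancillas)) *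
      A.unitaryOp.conjTranspose)).trace.re
  map_add' M N := by simp [liftOp_add, add_mul, mul_add]
  map_smul' c M := by simp [liftOp_smul]

lemma prob_eq_acceptance (ρ : QState n) : A.prob ρ = A.acceptance ρ.op := by
  rw [prob, initialOp_eq]
  rfl

lemma unitaryOp_mem : A.unitaryOp ∈ Matrix.unitaryGroup (QBasis (n + A.ancillas)) ℂ := by
  refine list_prod_mem fun M hM => ?_
  obtain ⟨p, -, rfl⟩ := List.mem_map.1 hM
  exact liftOp_mem_unitaryGroup _ (G.unitary _)

lemma initialOp_posSemidef (ρ : QState n) : (A.initialOp ρ).PosSemidef := by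
  set e := Fin.castAddEmb (n := n) A.ancillas
  have : A.initialOp ρ = (zeroOff e).conjTranspose * liftOp e ρ.op * zeroOff e := by
    rw [zeroOff_conjTranspose, ← liftOp_mul_zeroOff_comm, mul_assoc, zeroOff_mul_self,
      initialOp_eq]
  rw [this]
  exact (liftOp_posSemidef _ ρ.posSemidef).conjTranspose_mul_mul_same _

lemma prob_mem_Icc (ρ : QState n) : A.prob ρ ∈ Set.Icc (0 : ℝ) 1 := by
  set R := A.unitaryOp * A.initialOp ρ * A.unitaryOp.conjTranspose with hR
  have hpos : R.PosSemidef := (A.initialOp_posSemidef ρ).mul_mul_conjTranspose_same _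
  have htr : R.trace = 1 := by
    have h : A.unitaryOp.conjTranspose * A.unitaryOp = 1 :=
      Matrix.mem_unitaryGroup_iff'.1 A.unitaryOp_mem
    rw [hR, Matrix.trace_mul_comm, ← mul_assoc, h, one_mul, initialOp_eq,
      trace_liftOp_mul_zeroOff, ρ.trace_eq_one]
  have hd : ∀ x, 0 ≤ (R x x).re := fun x => (Complex.nonneg_iff.1 (hpos.diag_nonneg (i := x))).1
  have hprob : A.prob ρ = ∑ x, if x ⟨0, A.workspace_pos⟩ = true then (R x x).re else 0 := by
    rw [prob, outcomeOne, Matrix.trace, Complex.re_sum]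
    refine Finset.sum_congr rfl fun x _ => ?_
    rw [Matrix.diag_apply, Matrix.diagonal_mul]
    split_ifs <;> simp [hR]
  have hsum : ∑ x, (R x x).re = 1 := by
    have := congrArg Complex.re htr
    rwa [Matrix.trace, Complex.re_sum] at this
  rw [hprob]
  refine ⟨Finset.sum_nonneg fun x _ => ?_, hsum ▸ Finset.sum_le_sum fun x _ => ?_⟩
  · split_ifs
    exacts [hd x, le_rfl]
  · split_ifs
    exacts [le_rfl, hd x]

end Distinguisher

/-! ### Counting distinguishers of bounded size -/

/-- The largest arity of a gate. -/
def GateSet.maxArity (G : GateSet) : ℕ := Finset.univ.sup G.arity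

/-- The same gate, with its wires renamed along `e`. -/
def PlacedGate.map {G : GateSet} {w w' : ℕ} (e : Fin w ↪ Fin w') (p : PlacedGate G w) :
    PlacedGate G w' :=
  ⟨p.gate, p.wires.trans e⟩

lemma PlacedGate.toOp_map {G : GateSet} {w w' : ℕ} (e : Fin w ↪ Fin w') (p : PlacedGate G w) :
    (p.map e).toOp = liftOp e p.toOp :=
  (liftOp_liftOp p.wires e _).symm

lemma PlacedGate.mem_range_map {G : GateSet} {w w' : ℕ} (e : Fin w ↪ Fin w')
    (p : PlacedGate G w') (h : ∀ i, p.wires i ∈ Set.range e) :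
    p ∈ Set.range (PlacedGate.map (G := G) e) := by
  choose f hf using h
  refine ⟨⟨p.gate, ⟨f, fun i j hij => p.wires.injective ?_⟩⟩, ?_⟩
  · rw [← hf i, ← hf j, hij]
  · obtain ⟨g, v⟩ := p
    exact congrArg (PlacedGate.mk g) (Function.Embedding.ext hf)

/-- The renaming of wires that fixes the `n` input wires and renames the ancillas along `e`. -/
def ancillaEmb (n : ℕ) {a b : ℕ} (e : Fin a ↪ Fin b) : Fin (n + a) ↪ Fin (n + b) :=
  (finSumFinEquiv.symm.toEmbedding.trans ((Function.Embedding.refl _).sumMap e)).trans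
    finSumFinEquiv.toEmbedding

lemma ancillaEmb_castAdd (n : ℕ) {a b : ℕ} (e : Fin a ↪ Fin b) (i : Fin n) :
    ancillaEmb n e (Fin.castAdd a i) = Fin.castAdd b i := by
  simp [ancillaEmb]

lemma ancillaEmb_natAdd (n : ℕ) {a b : ℕ} (e : Fin a ↪ Fin b) (j : Fin a) :
    ancillaEmb n e (Fin.natAdd n j) = Fin.natAdd n (e j) := by
  simp [ancillaEmb]

namespace Distinguisher

variable {G : GateSet} {n : ℕ}

/-- Renaming the ancillas, or adding idle ones, does not change the acceptance probabilities. -/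
lemma prob_eq_of_gates_eq_map (hn : 0 < n) (A A' : Distinguisher G n)
    (e : Fin A.ancillas ↪ Fin A'.ancillas)
    (h : A'.gates = A.gates.map (PlacedGate.map (ancillaEmb n e))) (ρ : QState n) :
    A'.prob ρ = A.prob ρ := by
  set f := ancillaEmb n e with hf
  have hU : A'.unitaryOp = liftOp f A.unitaryOp := by
    have : ∀ l : List (PlacedGate G (n + A.ancillas)),
        ((l.map (PlacedGate.map f)).map PlacedGate.toOp).prod =
          liftOp f (l.map PlacedGate.toOp).prod := by
      intro l
      induction l with
      | nil => exact (liftOp_one f).symm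
      | cons p l ih =>
        simp only [List.map_cons, List.prod_cons, liftOp_mul, ih, PlacedGate.toOp_map]
    rw [unitaryOp, h, this, unitaryOp]
  have hO : A'.outcomeOne = liftOp f A.outcomeOne := by
    rw [outcomeOne, outcomeOne, liftOp_diagonal]
    refine congrArg _ (funext fun x => ?_)
    have : f ⟨0, A.workspace_pos⟩ = ⟨0, A'.workspace_pos⟩ := ancillaEmb_castAdd n e ⟨0, hn⟩
    rw [Function.comp_apply, this]
  have hc : Fin.castAddEmb A'.ancillas = (Fin.castAddEmb (n := n) A.ancillas).trans f :=
    Function.Embedding.ext fun i => (ancillaEmb_castAdd n e i).symm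
  rw [prob, prob, initialOp_eq, initialOp_eq, hU, hO, hc, zeroOff_trans, ← liftOp_liftOp,
    ← liftOp_conjTranspose]
  set I := liftOp (Fin.castAddEmb (n := n) A.ancillas) ρ.op
  set Q := zeroOff (Fin.castAddEmb (n := n) A.ancillas)
  rw [← trace_liftOp_mul_zeroOff f (A.outcomeOne * _)]
  simp only [liftOp_mul, mul_assoc, liftOp_mul_zeroOff_comm f A.unitaryOp.conjTranspose]

/-- A circuit with `s` gates touches at most `s * G.maxArity` ancillas, so that all others can be
dropped. -/
lemma exists_ancillas_eq (hn : 0 < n) {s : ℕ} (A : Distinguisher G n) (hA : A.size ≤ s) :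
    ∃ A' : Distinguisher G n, A'.size = A.size ∧ A'.ancillas = s * G.maxArity ∧
      ∀ ρ, A'.prob ρ = A.prob ρ := by
  classical
  set l : List (Fin (n + A.ancillas)) := A.gates.flatMap fun p => List.ofFn p.wires with hl
  set U : Finset (Fin A.ancillas) := Finset.univ.filter fun j => Fin.natAdd n j ∈ l with hU
  have hcard : U.card ≤ s * G.maxArity := by
    have h1 : U.card ≤ l.toFinset.card :=
      Finset.card_le_card_of_injOn (Fin.natAdd n) (fun j hj => by simpa [hU] using hj)
        fun i _ j _ hij => by simpa using hij
    have h2 : l.length ≤ A.size * G.maxArity := by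
      rw [hl, List.length_flatMap, size]
      refine (List.sum_le_card_nsmul _ G.maxArity ?_).trans (by simp)
      intro x hx
      obtain ⟨p, -, rfl⟩ := List.mem_map.1 hx
      rw [List.length_ofFn]
      exact Finset.le_sup (f := G.arity) (Finset.mem_univ _)
    exact (h1.trans l.toFinset_card_le).trans (h2.trans (Nat.mul_le_mul_right _ hA))
  set e : Fin U.card ↪ Fin A.ancillas := (U.orderEmbOfFin rfl).toEmbedding with he
  have hrange : ∀ p ∈ A.gates, p ∈ Set.range (PlacedGate.map (G := G) (ancillaEmb n e)) := by
    refine fun p hp => PlacedGate.mem_range_map _ p fun i => ?_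
    have hi : p.wires i ∈ l := List.mem_flatMap.2 ⟨p, hp, by simp⟩
    induction hw : p.wires i using Fin.addCases with
    | left j => exact ⟨_, ancillaEmb_castAdd n e j⟩
    | right j =>
      have hj : j ∈ (U : Set (Fin A.ancillas)) := by
        rw [hw] at hi
        simpa [hU] using hi
      rw [← U.range_orderEmbOfFin rfl] at hj
      obtain ⟨m, hm⟩ := hj
      refine ⟨Fin.natAdd n m, ?_⟩
      rw [ancillaEmb_natAdd, ← hm]
      rfl
  obtain ⟨gs, hgs⟩ : A.gates ∈ Set.range (List.map (PlacedGate.map (G := G) (ancillaEmb n e))) := by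
    rw [Set.range_list_map]
    exact hrange
  let A₀ : Distinguisher G n := ⟨U.card, by omega, gs⟩
  let c : Fin A₀.ancillas ↪ Fin (s * G.maxArity) := (Fin.castLEEmb hcard)
  let A₁ : Distinguisher G n :=
    ⟨s * G.maxArity, by omega, gs.map (PlacedGate.map (ancillaEmb n c))⟩
  refine ⟨A₁, ?_, rfl, fun ρ => ?_⟩
  · simp [A₁, size, ← hgs]
  · rw [prob_eq_of_gates_eq_map hn A₀ A₁ c rfl, prob_eq_of_gates_eq_map hn A₀ A e hgs.symm]

end Distinguisher

instance (G : GateSet) (w : ℕ) : Fintype (PlacedGate G w) :=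
  Fintype.ofEquiv (Σ g : Fin G.card, Fin (G.arity g) ↪ Fin w)
    ⟨fun p => ⟨p.1, p.2⟩, fun p => ⟨p.gate, p.wires⟩, fun _ => rfl, fun _ => rfl⟩

lemma PlacedGate.card_le (G : GateSet) {w : ℕ} (hw : 0 < w) :
    Fintype.card (PlacedGate G w) ≤ G.card * w ^ G.maxArity := by
  have : Fintype.card (PlacedGate G w) = Fintype.card (Σ g : Fin G.card, Fin (G.arity g) ↪ Fin w) :=
    Fintype.card_congr
      ⟨fun p => ⟨p.gate, p.wires⟩, fun p => ⟨p.1, p.2⟩, fun _ => rfl, fun _ => rfl⟩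
  rw [this, Fintype.card_sigma]
  refine (Finset.sum_le_card_nsmul _ _ (w ^ G.maxArity) fun g _ => ?_).trans (by simp)
  rw [Fintype.card_embedding_eq, Fintype.card_fin, Fintype.card_fin]
  exact (Nat.descFactorial_le_pow _ _).trans
    (Nat.pow_le_pow_right hw (Finset.le_sup (f := G.arity) (Finset.mem_univ g)))

/-- Up to their acceptance probabilities there are at most
`(G.card * (n + s * G.maxArity) ^ G.maxArity + 1) ^ s` distinguishers of size at most `s`,
although the number of ancillas is not bounded. -/
lemma exists_finite_distinguishers (G : GateSet) {n : ℕ} (hn : 0 < n) (s : ℕ) :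
    ∃ (ι : Type) (_ : Fintype ι) (D : ι → Distinguisher G n),
      Fintype.card ι ≤ (G.card * (n + s * G.maxArity) ^ G.maxArity + 1) ^ s ∧
      ∀ A : Distinguisher G n, A.size ≤ s → ∃ i, ∀ ρ, (D i).prob ρ = A.prob ρ := by
  classical
  -- circuits with fewer than `s` gates are padded with `none`
  refine ⟨List.Vector (Option (PlacedGate G (n + s * G.maxArity))) s, inferInstance,
    fun v => ⟨s * G.maxArity, by omega, v.1.reduceOption⟩, ?_, fun A hA => ?_⟩
  · rw [card_vector, Fintype.card_option]
    exact Nat.pow_le_pow_left (Nat.succ_le_succ (PlacedGate.card_le G (by omega))) s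
  · obtain ⟨⟨a, hpos, gs⟩, hsize, rfl, hprob⟩ := A.exists_ancillas_eq hn hA
    have hlen : gs.length ≤ s := hsize.trans_le hA
    refine ⟨⟨gs.map some ++ List.replicate (s - gs.length) none, by simp; omega⟩, fun ρ => ?_⟩
    rw [← hprob ρ]
    have : (gs.map some ++ List.replicate (s - gs.length) none).reduceOption = gs := by
      rw [List.reduceOption_append, List.reduceOption_replicate_none]
      simp [List.reduceOption]
    simp only [this]

/-! ### Random signs -/

/-- The sign `1` or `-1` encoded by a bit. -/
def bsign (b : Bool) : ℝ := if b then -1 else 1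

lemma exp_le_one_add_add_sq {x : ℝ} (hx : |x| ≤ 1) : Real.exp x ≤ 1 + x + x ^ 2 := by
  have := Real.abs_exp_sub_one_sub_id_le hx
  linarith [le_abs_self (Real.exp x - 1 - x)]

/-- Exponential moments of a Rademacher sum with coefficients in `[-1, 1]`. -/
lemma sum_exp_bsign_le {J : Type*} [Fintype J] [DecidableEq J] (c : J → ℝ) (hc : ∀ j, |c j| ≤ 1)
    {l : ℝ} (hl : |l| ≤ 1) :
    ∑ f : J → Bool, Real.exp (l * ∑ j, bsign (f j) * c j) ≤
      Fintype.card (J → Bool) * Real.exp (Fintype.card J * l ^ 2) := by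
  have h1 : ∀ f : J → Bool, Real.exp (l * ∑ j, bsign (f j) * c j) =
      ∏ j, Real.exp (l * (bsign (f j) * c j)) := fun f => by
    rw [Finset.mul_sum, Real.exp_sum]
  simp only [h1]
  rw [← Fintype.prod_sum (fun j b => Real.exp (l * (bsign b * c j)))]
  have h2 : ∀ j, ∑ b, Real.exp (l * (bsign b * c j)) ≤ 2 * Real.exp (l ^ 2) := by
    intro j
    have hb : |l * c j| ≤ 1 := by
      rw [abs_mul]
      exact mul_le_one₀ hl (abs_nonneg _) (hc j)
    have hsq : (l * c j) ^ 2 ≤ l ^ 2 := by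
      rw [mul_pow]
      exact mul_le_of_le_one_right (sq_nonneg _) ((sq_le_one_iff_abs_le_one _).2 (hc j))
    have e1 := exp_le_one_add_add_sq hb
    have e2 := exp_le_one_add_add_sq (x := -(l * c j)) (by rwa [abs_neg])
    have e3 := Real.add_one_le_exp (l ^ 2)
    simp only [Fintype.sum_bool, bsign, if_true, Bool.false_eq_true, if_false, one_mul, neg_mul,
      mul_neg]
    nlinarith
  refine (Finset.prod_le_prod (fun j _ => Finset.sum_nonneg fun b _ => (Real.exp_pos _).le)
    fun j _ => h2 j).trans ?_
  simp [mul_pow, Real.exp_nat_mul]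

/-- If there are fewer tests than the tail bound for Rademacher sums allows, some choice of signs
passes all of them. -/
lemma exists_signs {J ι : Type*} [Fintype J] [Fintype ι] (c : ι → J → ℝ)
    (hc : ∀ i j, |c i j| ≤ 1) {ε : ℝ} (hε : 0 < ε) (hε1 : ε ≤ 1)
    (hcard : 2 * Fintype.card ι * Real.exp (-(Fintype.card J * ε ^ 2 / 4)) < 1) :
    ∃ f : J → Bool, ∀ i, |∑ j, bsign (f j) * c i j| ≤ Fintype.card J * ε := by
  classical
  by_contra! hbad
  set K : ℝ := (Fintype.card J : ℝ)
  set N : ℝ := (Fintype.card (J → Bool) : ℝ) with hN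
  have hNpos : 0 < N := by
    rw [hN]
    exact_mod_cast Fintype.card_pos
  -- the exponent that balances the moment bound `K l ^ 2` against the deviation `K l ε`
  set l : ℝ := ε / 2 with hl
  have hl1 : |l| ≤ 1 := by rw [abs_of_pos (by positivity)]; linarith
  have hlow : ∀ f : J → Bool, Real.exp (l * (K * ε)) ≤
      ∑ i, (Real.exp (l * ∑ j, bsign (f j) * c i j) +
        Real.exp (-l * ∑ j, bsign (f j) * c i j)) := by
    intro f
    obtain ⟨i, hi⟩ := hbad f
    refine le_trans ?_ (Finset.single_le_sum (f := fun i =>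
      Real.exp (l * ∑ j, bsign (f j) * c i j) + Real.exp (-l * ∑ j, bsign (f j) * c i j))
      (fun i _ => by positivity) (Finset.mem_univ i))
    have hlp : 0 < l := by positivity
    rcases lt_abs.1 hi with h | h
    · have := Real.exp_le_exp.2 (mul_le_mul_of_nonneg_left h.le hlp.le)
      linarith [Real.exp_pos (-l * ∑ j, bsign (f j) * c i j)]
    · have := Real.exp_le_exp.2 (mul_le_mul_of_nonneg_left h.le hlp.le)
      rw [mul_neg, ← neg_mul] at this
      linarith [Real.exp_pos (l * ∑ j, bsign (f j) * c i j)]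
  have hsum := Finset.sum_le_sum fun f (_ : f ∈ (Finset.univ : Finset (J → Bool))) => hlow f
  rw [Finset.sum_const, Finset.card_univ, nsmul_eq_mul, ← hN, Finset.sum_comm] at hsum
  have hup : ∑ i, ∑ f : J → Bool, (Real.exp (l * ∑ j, bsign (f j) * c i j) +
      Real.exp (-l * ∑ j, bsign (f j) * c i j)) ≤
        Fintype.card ι * (2 * (N * Real.exp (K * l ^ 2))) := by
    refine (Finset.sum_le_card_nsmul _ _ (2 * (N * Real.exp (K * l ^ 2))) fun i _ => ?_).trans
      (by simp)
    rw [Finset.sum_add_distrib]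
    have e1 := sum_exp_bsign_le (c i) (hc i) hl1
    have e2 := sum_exp_bsign_le (c i) (hc i) (l := -l) (by rwa [abs_neg])
    rw [neg_sq] at e2
    linarith
  have hle := hsum.trans hup
  have hle' : Real.exp (l * (K * ε)) ≤ 2 * Fintype.card ι * Real.exp (K * l ^ 2) := by
    refine le_of_mul_le_mul_left ?_ hNpos
    linarith
  have e : Real.exp (K * l ^ 2) = Real.exp (l * (K * ε)) * Real.exp (-(K * ε ^ 2 / 4)) := by
    rw [← Real.exp_add, hl]
    congr 1
    ring
  rw [e] at hle'
  have := mul_lt_mul_of_pos_left hcard (Real.exp_pos (l * (K * ε)))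
  linarith

/-! ### Mixtures of orthonormal vectors -/

section Mixture

variable {n : ℕ} {ι : Type*} [Fintype ι] [DecidableEq ι]

/-- The mixture, with weights `W`, of the columns of an isometry `V`. -/
def mixture (V : Matrix (QBasis n) ι ℂ) (hV : V.conjTranspose * V = 1) (W : ι → ℝ)
    (hW : W ∈ stdSimplex ℝ ι) : QState n where
  op := V * Matrix.diagonal (fun i => (W i : ℂ)) * V.conjTranspose
  posSemidef := (Matrix.PosSemidef.diagonal fun i => by
    simpa using hW.1 i).mul_mul_conjTranspose_same V
  trace_eq_one := by
    rw [Matrix.trace_mul_comm, ← Matrix.mul_assoc, hV, Matrix.one_mul, Matrix.trace_diagonal,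
      ← Complex.ofReal_sum, hW.2, Complex.ofReal_one]

variable {V : Matrix (QBasis n) ι ℂ} (hV : V.conjTranspose * V = 1)

lemma mixture_op {W : ι → ℝ} (hW : W ∈ stdSimplex ℝ ι) :
    (mixture V hV W hW).op = V * Matrix.diagonal (fun i => (W i : ℂ)) * V.conjTranspose :=
  rfl

lemma mul_diagonal_mul_conjTranspose (V : Matrix (QBasis n) ι ℂ) (W : ι → ℝ) :
    V * Matrix.diagonal (fun i => (W i : ℂ)) * V.conjTranspose =
      ∑ i, W i • Matrix.vecMulVec (V.col i) (star (V.col i)) := by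
  ext x y
  rw [Matrix.mul_apply, Matrix.sum_apply]
  refine Finset.sum_congr rfl fun i _ => ?_
  simp [Matrix.mul_diagonal, Matrix.vecMulVec_apply]
  ring

variable {G : GateSet} (A : Distinguisher G n)

lemma prob_mixture {W : ι → ℝ} (hW : W ∈ stdSimplex ℝ ι) :
    A.prob (mixture V hV W hW) =
      ∑ i, W i * A.acceptance (Matrix.vecMulVec (V.col i) (star (V.col i))) := by
  rw [A.prob_eq_acceptance, mixture_op, mul_diagonal_mul_conjTranspose, map_sum]
  simp

include hV in
lemma acceptance_col_mem_Icc (i : ι) :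
    A.acceptance (Matrix.vecMulVec (V.col i) (star (V.col i))) ∈ Set.Icc (0 : ℝ) 1 := by
  have h := A.prob_mem_Icc (mixture V hV (Pi.single i 1) (single_mem_stdSimplex ℝ i))
  rw [prob_mixture hV A] at h
  simpa [Pi.single_apply] using h

/-- If `W` contains a `1 - p` fraction of `W'`, then the two mixtures are statistically
`p`-close. -/
lemma abs_prob_mixture_sub_le {W W' : ι → ℝ} (hW : W ∈ stdSimplex ℝ ι)
    (hW' : W' ∈ stdSimplex ℝ ι) {p : ℝ} (h : ∀ i, (1 - p) * W' i ≤ W i) :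
    |A.prob (mixture V hV W hW) - A.prob (mixture V hV W' hW')| ≤ p := by
  rw [prob_mixture, prob_mixture]
  set t := fun i => A.acceptance (Matrix.vecMulVec (V.col i) (star (V.col i)))
  have ht : ∀ i, t i ∈ Set.Icc (0 : ℝ) 1 := acceptance_col_mem_Icc hV A
  have h1 : ∑ i, ((1 - p) * W' i) * t i ≤ ∑ i, W i * t i :=
    Finset.sum_le_sum fun i _ => mul_le_mul_of_nonneg_right (h i) (ht i).1
  have h2 : ∑ i, (W i - (1 - p) * W' i) * t i ≤ ∑ i, (W i - (1 - p) * W' i) :=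
    Finset.sum_le_sum fun i _ => mul_le_of_le_one_right (by linarith [h i]) (ht i).2
  have h3 : 0 ≤ ∑ i, W' i * t i := Finset.sum_nonneg fun i _ => mul_nonneg (hW'.1 i) (ht i).1
  have h4 : ∑ i, W' i * t i ≤ 1 := by
    rw [← hW'.2]
    exact Finset.sum_le_sum fun i _ => mul_le_of_le_one_right (hW'.1 i) (ht i).2
  have h5 : 0 ≤ p := by
    have := Finset.sum_le_sum fun i (_ : i ∈ Finset.univ) => h i
    rw [← Finset.mul_sum, hW.2, hW'.2] at this
    linarith
  simp only [sub_mul, mul_assoc, Finset.sum_sub_distrib, ← Finset.mul_sum, hW.2, hW'.2] at h1 h2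
  rw [abs_le]
  constructor <;> nlinarith

include hV in
/-- The multiple `c` of the identity dominates a mixture of orthonormal vectors if and only if all
weights are at most `c`. -/
lemma posSemidef_smul_one_sub_iff {W : ι → ℝ} {c : ℝ} (hc : 0 ≤ c) :
    (c • (1 : QOp n) - V * Matrix.diagonal (fun i => (W i : ℂ)) * V.conjTranspose).PosSemidef ↔
      ∀ i, W i ≤ c := by
  constructor
  · intro h i
    have h' := (h.conjTranspose_mul_mul_same V).diag_nonneg (i := i)
    have e : V.conjTranspose * (c • (1 : QOp n) -
        V * Matrix.diagonal (fun i => (W i : ℂ)) * V.conjTranspose) * V =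
        c • (1 : Matrix ι ι ℂ) - Matrix.diagonal (fun i => (W i : ℂ)) := by
      rw [Matrix.mul_sub, Matrix.sub_mul, Matrix.mul_smul, Matrix.mul_one, Matrix.smul_mul, hV]
      congr 1
      calc V.conjTranspose * (V * Matrix.diagonal (fun i => (W i : ℂ)) * V.conjTranspose) * V
          = (V.conjTranspose * V) * Matrix.diagonal (fun i => (W i : ℂ)) *
              (V.conjTranspose * V) := by simp only [Matrix.mul_assoc]
        _ = _ := by rw [hV, Matrix.one_mul, Matrix.mul_one]
    rw [e] at h'
    have := (Complex.nonneg_iff.1 h').1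
    simpa using this
  · intro h
    have e : c • (1 : QOp n) - V * Matrix.diagonal (fun i => (W i : ℂ)) * V.conjTranspose =
        c • ((1 - V * V.conjTranspose).conjTranspose * (1 - V * V.conjTranspose)) +
          V * Matrix.diagonal (fun i => ((c - W i : ℝ) : ℂ)) * V.conjTranspose := by
      have e1 : (1 - V * V.conjTranspose).conjTranspose * (1 - V * V.conjTranspose) =
          1 - V * V.conjTranspose := by
        have : V * V.conjTranspose * (V * V.conjTranspose) = V * V.conjTranspose := by
          rw [← Matrix.mul_assoc, Matrix.mul_assoc V, hV, Matrix.mul_one]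
        rw [Matrix.conjTranspose_sub, Matrix.conjTranspose_mul, Matrix.conjTranspose_conjTranspose,
          Matrix.conjTranspose_one, mul_sub, mul_one, sub_mul, one_mul, this, sub_self, sub_zero]
      have e2 : Matrix.diagonal (fun i => ((c - W i : ℝ) : ℂ)) =
          c • (1 : Matrix ι ι ℂ) - Matrix.diagonal (fun i => (W i : ℂ)) := by
        ext i j
        by_cases hij : i = j <;> simp [hij]
      rw [e1, e2, Matrix.mul_sub, Matrix.sub_mul, Matrix.mul_smul, Matrix.mul_one,
        Matrix.smul_mul, smul_sub]
      abel
    rw [e]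
    refine ((Matrix.posSemidef_conjTranspose_mul_self _).smul hc).add
      ((Matrix.PosSemidef.diagonal fun i => ?_).mul_mul_conjTranspose_same V)
    simpa using h i

lemma relMinEntropy_le_of_posSemidef {ρ σ : QState n} {l : ℝ}
    (h : ((2 : ℝ) ^ l • σ.op - ρ.op).PosSemidef) : relMinEntropy ρ σ ≤ l :=
  sInf_le ⟨l, h, rfl⟩

lemma minEntropy_mixture {W : ι → ℝ} (hW : W ∈ stdSimplex ℝ ι) {m : ℕ}
    (hle : ∀ i, W i ≤ ((2 : ℝ) ^ m)⁻¹) (heq : ∃ i, W i = ((2 : ℝ) ^ m)⁻¹) :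
    minEntropy (mixture V hV W hW) = m := by
  have hset : {l : ℝ | ((2 : ℝ) ^ l • (maximallyMixed n).op - (mixture V hV W hW).op).PosSemidef} =
      Set.Ici ((n : ℝ) - m) := by
    ext l
    have hc : (0 : ℝ) ≤ (2 : ℝ) ^ l * ((2 : ℝ) ^ n)⁻¹ := by positivity
    have e : ((2 : ℝ) ^ l * ((2 : ℝ) ^ n)⁻¹) = (2 : ℝ) ^ (l - n) := by
      rw [Real.rpow_sub two_pos, Real.rpow_natCast, div_eq_mul_inv]
    have e' : ((2 : ℝ) ^ m)⁻¹ = (2 : ℝ) ^ (-(m : ℝ)) := by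
      rw [Real.rpow_neg two_pos.le, Real.rpow_natCast]
    rw [Set.mem_ofPred_eq, Set.mem_Ici, maximallyMixed, mixture, smul_smul,
      posSemidef_smul_one_sub_iff hV hc]
    have : (∀ i, W i ≤ (2 : ℝ) ^ l * ((2 : ℝ) ^ n)⁻¹) ↔
        ((2 : ℝ) ^ m)⁻¹ ≤ (2 : ℝ) ^ l * ((2 : ℝ) ^ n)⁻¹ := by
      obtain ⟨i, hi⟩ := heq
      exact ⟨fun h => hi ▸ h i, fun h j => (hle j).trans h⟩
    rw [this, e, e', Real.rpow_le_rpow_left_iff one_lt_two]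
    constructor <;> intro h <;> linarith
  have hD : relMinEntropy (mixture V hV W hW) (maximallyMixed n) = (((n : ℝ) - m : ℝ) : EReal) := by
    rw [relMinEntropy, hset]
    exact (EReal.coe_strictMono.monotone.map_isLeast isLeast_Ici).isGLB.sInf_eq
  rw [minEntropy, hD, ← EReal.coe_natCast, ← EReal.coe_natCast, ← EReal.coe_sub]
  norm_num

open scoped MatrixOrder in
include hV in
/-- A state dominated by a multiple of a mixture of the columns of `V` is supported on the range
of `V`, and an observable whose compression to that range is scalar cannot tell it apart from
any other such state. -/
lemma trace_mul_of_dominated {E : QOp n} {a : ℂ} (hE : V.conjTranspose * E * V = a • 1)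
    (D : Matrix ι ι ℂ) (c : ℝ) (ρ : QState n)
    (h : (c • (V * D * V.conjTranspose) - ρ.op).PosSemidef) : (E * ρ.op).trace = a := by
  obtain ⟨Q, hQ⟩ : ∃ Q : QOp n, Q = 1 - V * V.conjTranspose := ⟨_, rfl⟩
  have hQH : Q.conjTranspose = Q := by simp [hQ]
  have hQV : Q * V = 0 := by rw [hQ, Matrix.sub_mul, Matrix.mul_assoc, hV]; simp
  have h1 : (-(Q * ρ.op * Q)).PosSemidef := by
    have := h.conjTranspose_mul_mul_same Q
    rwa [hQH, mul_sub, sub_mul, mul_smul_comm, ← Matrix.mul_assoc Q, ← Matrix.mul_assoc Q, hQV,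
      Matrix.zero_mul, Matrix.zero_mul, smul_zero, zero_mul, zero_sub] at this
  obtain ⟨B, hB⟩ := CStarAlgebra.nonneg_iff_eq_star_mul_self.1 ρ.posSemidef.nonneg
  rw [Matrix.star_eq_conjTranspose] at hB
  have h2 : Q * ρ.op * Q = (B * Q).conjTranspose * (B * Q) := by
    rw [hB, Matrix.conjTranspose_mul, hQH]
    simp only [Matrix.mul_assoc]
  have h3 : (B * Q).conjTranspose * (B * Q) = 0 := by
    rw [h2] at h1
    refine le_antisymm ?_ (Matrix.posSemidef_conjTranspose_mul_self _).nonneg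
    rw [← neg_nonneg]
    exact h1.nonneg
  have h4 : ρ.op * Q = 0 := by
    rw [hB, mul_assoc, Matrix.conjTranspose_mul_self_eq_zero.1 h3, mul_zero]
  have h5 : ρ.op = ρ.op * (V * V.conjTranspose) := by
    rwa [hQ, mul_sub, mul_one, sub_eq_zero] at h4
  have h6 : ρ.op = V * V.conjTranspose * ρ.op := by
    have := congrArg Matrix.conjTranspose h5
    rwa [Matrix.conjTranspose_mul, Matrix.conjTranspose_mul, Matrix.conjTranspose_conjTranspose,
      ρ.posSemidef.isHermitian.eq] at this
  calc (E * ρ.op).trace = (E * (V * V.conjTranspose * (ρ.op * (V * V.conjTranspose)))).trace := by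
        rw [← h5, ← h6]
    _ = ((E * V * (V.conjTranspose * ρ.op * V)) * V.conjTranspose).trace := by
        simp only [Matrix.mul_assoc]
    _ = (V.conjTranspose * E * V * (V.conjTranspose * ρ.op * V)).trace := by
        rw [Matrix.trace_mul_comm]
        simp only [Matrix.mul_assoc]
    _ = a * (ρ.op * (V * V.conjTranspose)).trace := by
        rw [hE, Matrix.smul_mul, Matrix.one_mul, Matrix.trace_smul, Matrix.mul_assoc,
          Matrix.trace_mul_comm, Matrix.mul_assoc, smul_eq_mul]
    _ = a := by rw [← h5, ρ.trace_eq_one, mul_one]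

end Mixture

/-- Weights with a prescribed maximum `a` that contain a `1 - a` fraction of the uniform ones: one
index has weight `a` and all others have the same weight. -/
lemma exists_weights {ι : Type*} [Fintype ι] [Nonempty ι] {a : ℝ}
    (h1 : (Fintype.card ι : ℝ)⁻¹ ≤ a) (h2 : a ≤ 1) :
    ∃ W ∈ stdSimplex ℝ ι, (∀ i, W i ≤ a) ∧ (∃ i, W i = a) ∧
      ∀ i, (1 - a) * (Fintype.card ι : ℝ)⁻¹ ≤ W i := by
  classical
  obtain ⟨i₀⟩ := ‹Nonempty ι›
  set N : ℝ := (Fintype.card ι : ℝ) with hN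
  have hN1 : 1 ≤ N := by
    rw [hN]
    exact_mod_cast Fintype.card_pos_iff.2 ⟨i₀⟩
  have ha0 : 0 ≤ a := le_trans (by positivity) h1
  have haN : 1 ≤ a * N := by rwa [inv_le_iff_one_le_mul₀ (by linarith)] at h1
  have hb : (1 - a) / (N - 1) ≤ a := by
    rcases hN1.eq_or_lt with h | h
    · simp [← h, ha0]
    · rw [div_le_iff₀ (by linarith)]
      linarith
  have hb0 : 0 ≤ (1 - a) / (N - 1) := div_nonneg (by linarith) (by linarith)
  refine ⟨fun i => if i = i₀ then a else (1 - a) / (N - 1), ⟨fun i => ?_, ?_⟩, fun i => ?_,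
    ⟨i₀, if_pos rfl⟩, fun i => ?_⟩
  · dsimp only
    split_ifs
    exacts [ha0, hb0]
  · rw [← Finset.add_sum_erase _ _ (Finset.mem_univ i₀), if_pos rfl,
      Finset.sum_congr rfl fun i hi => if_neg (Finset.ne_of_mem_erase hi), Finset.sum_const,
      Finset.card_erase_of_mem (Finset.mem_univ i₀), Finset.card_univ, nsmul_eq_mul,
      Nat.cast_sub (Fintype.card_pos_iff.2 ⟨i₀⟩), ← hN, Nat.cast_one]
    rcases hN1.eq_or_lt with h | h
    · rw [← h] at haN ⊢
      simp
      linarith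
    · rw [mul_div_cancel₀ _ (by linarith)]
      ring
  · dsimp only
    split_ifs
    exacts [le_rfl, hb]
  · have hlow : (1 - a) * N⁻¹ ≤ a := by
      refine le_trans (mul_le_of_le_one_left (by positivity) (by linarith)) h1
    dsimp only
    split_ifs with h
    · exact hlow
    · rcases hN1.eq_or_lt with h' | h'
      · rw [← h'] at haN ⊢
        simp
        linarith
      · rw [← div_eq_mul_inv]
        exact div_le_div_of_nonneg_left (by linarith) (by linarith) (by linarith)

/-! ### The states -/

lemma sum_qbasis_succ {R : Type*} [AddCommMonoid R] {k : ℕ} (F : QBasis (k + 1) → R) :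
    ∑ x, F x = ∑ t : QBasis k, (F (Fin.cons false t) + F (Fin.cons true t)) := by
  rw [← (Fin.consEquiv fun _ : Fin (k + 1) => Bool).sum_comp, Fintype.sum_prod_type,
    Fintype.sum_bool, add_comm, ← Finset.sum_add_distrib]
  rfl

/-- The amplitude of `|b⟩` in `(|0⟩ ± |1⟩) / √2`, the sign being given by `c`. -/
def signAmp (c b : Bool) : ℝ := (if b then bsign c else 1) / √2

/-- The matrix whose `j`-th column is `(|0,j⟩ ± |1,j⟩) / √2`, the sign being given by `w j`. -/
def signMatrix {k : ℕ} (w : QBasis k → Bool) : Matrix (QBasis (k + 1)) (QBasis k) ℂ :=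
  Matrix.of fun x j => if Fin.tail x = j then (signAmp (w j) (x 0) : ℂ) else 0

/-- The projector onto the outcome `1` of the first qubit. -/
def firstQubitOne (k : ℕ) : QOp (k + 1) :=
  Matrix.diagonal fun x => if x 0 = true then 1 else 0

/-- The distinguisher without gates, which measures the first input qubit. -/
def measureFirst (G : GateSet) (k : ℕ) : Distinguisher G (k + 1) := ⟨0, by omega, []⟩

lemma signAmp_mul_self (c b : Bool) : (signAmp c b : ℂ) * signAmp c b = 1 / 2 := by
  rw [← Complex.ofReal_mul, signAmp, div_mul_div_comm, Real.mul_self_sqrt two_pos.le]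
  cases b <;> cases c <;> simp [bsign]

lemma signAmp_mul_add (b b' : Bool) :
    (signAmp false b : ℂ) * signAmp false b' + signAmp true b * signAmp true b' =
      if b = b' then 1 else 0 := by
  rw [← Complex.ofReal_mul, ← Complex.ofReal_mul, ← Complex.ofReal_add]
  simp only [signAmp, div_mul_div_comm, Real.mul_self_sqrt two_pos.le]
  cases b <;> cases b' <;> norm_num [bsign]

section

variable {k : ℕ} (w : QBasis k → Bool)

lemma signMatrix_cons (b : Bool) (t j : QBasis k) :
    signMatrix w (Fin.cons b t) j =
      if t = j then (signAmp (w j) b : ℂ) else 0 := by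
  simp [signMatrix]

lemma signMatrix_isometry : (signMatrix w).conjTranspose * signMatrix w = 1 := by
  ext i j
  rw [Matrix.mul_apply, sum_qbasis_succ]
  simp only [Matrix.conjTranspose_apply, signMatrix_cons]
  by_cases hij : i = j
  · subst hij
    rw [Finset.sum_eq_single i (fun t _ ht => by simp [ht]) (by simp)]
    simp only [if_true, Complex.star_def, Complex.conj_ofReal, signAmp_mul_self]
    norm_num
  · rw [Matrix.one_apply_ne hij]
    refine Finset.sum_eq_zero fun t _ => ?_
    by_cases h : t = i
    · simp [h, hij]
    · simp [h]

/-- Every state supported on the range of `signMatrix w` has an unbiased first qubit. -/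
lemma signMatrix_compress_firstQubitOne :
    (signMatrix w).conjTranspose * firstQubitOne k * signMatrix w = (1 / 2 : ℂ) • 1 := by
  ext i j
  rw [Matrix.mul_apply, sum_qbasis_succ]
  simp only [firstQubitOne, Matrix.mul_diagonal, Matrix.conjTranspose_apply, signMatrix_cons,
    Fin.cons_zero]
  by_cases hij : i = j
  · subst hij
    rw [Finset.sum_eq_single i (fun t _ ht => by simp [ht]) (by simp)]
    simp only [if_true, Complex.star_def, Complex.conj_ofReal, mul_one, signAmp_mul_self]
    simp
  · rw [Matrix.smul_apply, Matrix.one_apply_ne hij, smul_zero]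
    refine Finset.sum_eq_zero fun t _ => ?_
    by_cases h : t = i
    · simp [h, hij]
    · simp [h]

lemma prob_measureFirst (G : GateSet) (ρ : QState (k + 1)) :
    (measureFirst G k).prob ρ = (firstQubitOne k * ρ.op).trace.re := by
  have : (measureFirst G k).initialOp ρ = ρ.op := by
    ext x y
    simp [Distinguisher.initialOp, measureFirst]
    rfl
  rw [Distinguisher.prob, this]
  change (firstQubitOne k * ((1 : QOp (k + 1)) * ρ.op * (1 : QOp (k + 1)).conjTranspose)).trace.re
    = _
  rw [Matrix.conjTranspose_one, one_mul, mul_one]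

lemma uniform_mem_stdSimplex (ι : Type*) [Fintype ι] [Nonempty ι] :
    (fun _ : ι => (Fintype.card ι : ℝ)⁻¹) ∈ stdSimplex ℝ ι :=
  ⟨fun _ => by positivity, by simp⟩

/-- The weights of a product of a bit that is `1` with probability `t` and a random `k`-bit string
with weights `W`. -/
def biasedWeights (t : ℝ) (W : QBasis k → ℝ) : QBasis (k + 1) → ℝ :=
  fun x => (if x 0 then t else 1 - t) * W (Fin.tail x)

lemma biasedWeights_mem {t : ℝ} (ht : t ∈ Set.Icc (0 : ℝ) 1) {W : QBasis k → ℝ}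
    (hW : W ∈ stdSimplex ℝ (QBasis k)) : biasedWeights t W ∈ stdSimplex ℝ (QBasis (k + 1)) := by
  refine ⟨fun x => mul_nonneg ?_ (hW.1 _), ?_⟩
  · split_ifs <;> linarith [ht.1, ht.2]
  · rw [sum_qbasis_succ]
    simp [biasedWeights, ← add_mul, hW.2]

/-- The diagonal state that is the product of a biased first qubit and a mixture of basis states
of the other qubits. -/
def biasedState {t : ℝ} (ht : t ∈ Set.Icc (0 : ℝ) 1) {W : QBasis k → ℝ}
    (hW : W ∈ stdSimplex ℝ (QBasis k)) : QState (k + 1) :=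
  mixture 1 (by simp) (biasedWeights t W) (biasedWeights_mem ht hW)

/-- The mixture, with weights `W`, of the vectors `(|0,j⟩ ± |1,j⟩) / √2` with signs `w`. -/
def signState (w : QBasis k → Bool) {W : QBasis k → ℝ} (hW : W ∈ stdSimplex ℝ (QBasis k)) :
    QState (k + 1) :=
  mixture (signMatrix w) (signMatrix_isometry w) W hW

lemma biasedState_op {t : ℝ} (ht : t ∈ Set.Icc (0 : ℝ) 1) {W : QBasis k → ℝ}
    (hW : W ∈ stdSimplex ℝ (QBasis k)) :
    (biasedState ht hW).op = Matrix.diagonal fun x => (biasedWeights t W x : ℂ) := by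
  simp [biasedState, mixture_op]

lemma prob_measureFirst_biasedState (G : GateSet) {t : ℝ} (ht : t ∈ Set.Icc (0 : ℝ) 1)
    {W : QBasis k → ℝ} (hW : W ∈ stdSimplex ℝ (QBasis k)) :
    (measureFirst G k).prob (biasedState ht hW) = t := by
  rw [prob_measureFirst, biasedState_op, firstQubitOne, Matrix.diagonal_mul_diagonal,
    Matrix.trace_diagonal, sum_qbasis_succ, Complex.re_sum]
  simp [biasedWeights, ← Finset.mul_sum, hW.2]

lemma prob_measureFirst_of_dominated (G : GateSet) {W : QBasis k → ℝ}
    (hW : W ∈ stdSimplex ℝ (QBasis k)) (c : ℝ) (ρ : QState (k + 1))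
    (h : (c • (signState w hW).op - ρ.op).PosSemidef) : (measureFirst G k).prob ρ = 1 / 2 := by
  rw [prob_measureFirst, trace_mul_of_dominated (signMatrix_isometry w)
    (signMatrix_compress_firstQubitOne w) _ c ρ h]
  norm_num

lemma biasedState_half_uniform (ht : (1 / 2 : ℝ) ∈ Set.Icc (0 : ℝ) 1) :
    biasedState ht (uniform_mem_stdSimplex (QBasis k)) = maximallyMixed (k + 1) := by
  have h : (biasedState ht (uniform_mem_stdSimplex (QBasis k))).op =
      (maximallyMixed (k + 1)).op := by
    rw [biasedState_op, maximallyMixed]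
    ext x y
    by_cases hxy : x = y
    · subst hxy
      simp only [biasedWeights, Matrix.diagonal_apply_eq, Matrix.smul_apply, Matrix.one_apply_eq,
        Complex.real_smul, mul_one]
      congr 1
      norm_num [pow_succ, mul_comm]
    · simp [hxy]
  cases hb : biasedState ht (uniform_mem_stdSimplex (QBasis k))
  rw [hb] at h
  cases h
  rfl

/-- The vectors with both signs together resolve the identity. -/
lemma sum_signMatrix_vecMulVec :
    ∑ j : QBasis k, (Matrix.vecMulVec ((signMatrix fun _ => false).col j)
        (star ((signMatrix fun _ => false).col j)) +
      Matrix.vecMulVec ((signMatrix fun _ => true).col j)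
        (star ((signMatrix fun _ => true).col j))) = (1 : QOp (k + 1)) := by
  ext x y
  rw [← Fin.cons_self_tail x, ← Fin.cons_self_tail y]
  rw [Matrix.sum_apply]
  simp only [Matrix.add_apply, Matrix.vecMulVec_apply, Matrix.col_apply, Pi.star_apply,
    signMatrix_cons]
  by_cases hxy : Fin.tail x = Fin.tail y
  · rw [Finset.sum_eq_single (Fin.tail x) (fun t _ ht => by simp [ht.symm]) (by simp)]
    simp only [hxy, if_true, Complex.star_def, Complex.conj_ofReal, signAmp_mul_add,
      Matrix.one_apply, Fin.cons_inj, and_true]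
  · rw [Matrix.one_apply_ne fun h => hxy (by simpa using congrArg Fin.tail h)]
    refine Finset.sum_eq_zero fun t _ => ?_
    by_cases h : Fin.tail x = t
    · simp [← h, Ne.symm hxy]
    · simp [h]

end

/-- For suitable signs the uniform mixture of the vectors `(|0,j⟩ ± |1,j⟩) / √2` fools all small
circuits: the advantage of a circuit against the maximally mixed state is a Rademacher sum in
these signs. -/
lemma exists_signState_indist (G : GateSet) (k s : ℕ) {ε : ℝ} (hε : 0 < ε) (hε1 : ε ≤ 1)
    (h : 2 * (((G.card * (k + 1 + s * G.maxArity) ^ G.maxArity + 1) ^ s : ℕ) : ℝ) *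
      Real.exp (-(2 ^ k * ε ^ 2 / 4)) < 1) :
    ∃ w : QBasis k → Bool, Indist G s ε (signState w (uniform_mem_stdSimplex (QBasis k)))
      (maximallyMixed (k + 1)) := by
  obtain ⟨ι, _, D, hcard, hD⟩ := exists_finite_distinguishers G k.succ_pos s
  set t : ι → Bool → QBasis k → ℝ := fun i b j => (D i).acceptance
    (Matrix.vecMulVec ((signMatrix fun _ => b).col j) (star ((signMatrix fun _ => b).col j)))
    with ht
  have ht1 : ∀ i b j, t i b j ∈ Set.Icc (0 : ℝ) 1 := fun i b j =>
    acceptance_col_mem_Icc (signMatrix_isometry _) (D i) j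
  obtain ⟨w, hw⟩ := exists_signs (ι := ι) (J := QBasis k)
    (fun i j => (t i false j - t i true j) / 2)
    (fun i j => by
      obtain ⟨h1, h2⟩ := ht1 i false j
      obtain ⟨h3, h4⟩ := ht1 i true j
      rw [abs_le]
      constructor <;> linarith) hε hε1 (by
        refine lt_of_le_of_lt ?_ h
        have e : (Fintype.card (QBasis k) : ℝ) = 2 ^ k := by simp
        rw [e]
        gcongr)
  refine ⟨w, fun A hA => ?_⟩
  obtain ⟨i, hi⟩ := hD A hA
  have hK : (0 : ℝ) < Fintype.card (QBasis k) := by exact_mod_cast Fintype.card_pos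
  set K : ℝ := (Fintype.card (QBasis k) : ℝ) with hKdef
  have h1 : (D i).prob (signState w (uniform_mem_stdSimplex (QBasis k))) =
      K⁻¹ * ∑ j, t i (w j) j := by
    rw [signState, prob_mixture, ← Finset.mul_sum]
    rfl
  have h2 : (D i).prob (maximallyMixed (k + 1)) =
      K⁻¹ * ∑ j, (t i false j + t i true j) / 2 := by
    have e : (maximallyMixed (k + 1)).op = (K⁻¹ / 2) • (1 : QOp (k + 1)) := by
      have : ((2 : ℝ) ^ (k + 1))⁻¹ = K⁻¹ / 2 := by
        simp [hKdef, pow_succ]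
        ring
      rw [← this]
      rfl
    rw [Distinguisher.prob_eq_acceptance, e, map_smul, ← sum_signMatrix_vecMulVec, map_sum,
      ← Finset.sum_div]
    simp only [map_add, smul_eq_mul]
    ring
  rw [Distinguisher.advantage, ← hi, ← hi, h1, h2, ← mul_sub, ← Finset.sum_sub_distrib, abs_mul,
    abs_of_pos (inv_pos.2 hK), inv_mul_le_iff₀ hK]
  refine le_of_eq_of_le (congrArg _ (Finset.sum_congr rfl fun j _ => ?_)) (hw i)
  cases w j <;> simp [bsign] <;> ring

/-! ### Parameters -/

lemma exists_const_mul_pow_le_two_pow (D : ℝ) (a : ℕ) :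
    ∃ N : ℕ, ∀ n : ℕ, N ≤ n → D * (n : ℝ) ^ a ≤ 2 ^ n := by
  have h := (tendsto_pow_const_div_const_pow_of_one_lt a (one_lt_two (α := ℝ))).const_mul D
  rw [mul_zero] at h
  obtain ⟨N, hN⟩ := Filter.eventually_atTop.1 (h.eventually_le_const one_pos)
  refine ⟨N, fun n hn => ?_⟩
  have := hN n hn
  rwa [← mul_div_assoc, div_le_one (by positivity)] at this

lemma two_le_logb_div {s : ℕ} {ε : ℝ} (hs : 0 < s) (hε : 0 < ε) (hε1 : ε ≤ 1 / 4) :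
    2 ≤ Real.logb 2 (s / ε) := by
  have h4 : (4 : ℝ) ≤ s / ε := by
    have : (1 : ℝ) ≤ s := by exact_mod_cast hs
    rw [le_div_iff₀ hε]
    linarith
  rw [Real.le_logb_iff_rpow_le one_lt_two (by linarith)]
  norm_num
  exact h4

/-- With `n > C log (s / ε)` qubits the union bound over all circuits of size `s` is beaten by the
tail bound for Rademacher sums with `2 ^ (n - 1)` terms. -/
lemma exists_const_union_bound (G : GateSet) :
    ∃ C : ℝ, 3 ≤ C ∧ ∀ (s : ℕ) (ε : ℝ) (k : ℕ), 0 < s → 0 < ε → ε ≤ 1 / 4 →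
      C * Real.logb 2 (s / ε) < (k + 1 : ℕ) →
      2 * (((G.card * (k + 1 + s * G.maxArity) ^ G.maxArity + 1) ^ s : ℕ) : ℝ) *
        Real.exp (-(2 ^ k * (ε / 2) ^ 2 / 4)) < 1 := by
  set a := G.maxArity with ha
  set D : ℝ := 1 + G.card * ((a : ℝ) + 1) ^ a with hD
  have hD1 : 1 ≤ D := by
    have : 0 ≤ (G.card : ℝ) * ((a : ℝ) + 1) ^ a := by positivity
    linarith
  obtain ⟨N, hN⟩ := exists_const_mul_pow_le_two_pow ((32 * D) ^ 2) (a * 2)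
  -- `N` makes the polynomial in `n` at most `2 ^ (n / 2)`, and `2 * (a + 3)` does the same for the
  -- power `(s / ε) ^ (a + 3)`
  refine ⟨N + 2 * (a + 3), by
    have : (0 : ℝ) ≤ N := by positivity
    have : (0 : ℝ) ≤ a := by positivity
    linarith, fun s ε k hs hε hε1 hn => ?_⟩
  set n := k + 1 with hnk
  have hL := two_le_logb_div hs hε hε1
  set L := Real.logb 2 (s / ε) with hLdef
  have hs1 : (1 : ℝ) ≤ s := by exact_mod_cast hs
  set T : ℝ := s / ε with hT
  have hTpos : 0 < T := by positivity
  have hsT : (s : ℝ) ≤ T := by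
    rw [hT, le_div_iff₀ hε]
    nlinarith
  have hT1 : 1 ≤ T := hs1.trans hsT
  have hεT : 1 ≤ ε * T := by
    rw [hT, mul_div_cancel₀ _ hε.ne']
    exact hs1
  have hN0 : (0 : ℝ) ≤ N := by positivity
  have ha0 : (0 : ℝ) ≤ a := by positivity
  have hn1 : (1 : ℝ) ≤ n := by
    rw [hnk]
    push_cast
    linarith [k.cast_nonneg (α := ℝ)]
  have hNn : N ≤ n := by
    have : (N : ℝ) ≤ n := by nlinarith
    exact_mod_cast this
  have hTn : T ^ ((a + 3) * 2) ≤ 2 ^ n := by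
    have h2L : T = (2 : ℝ) ^ L := (Real.rpow_logb two_pos (by norm_num) hTpos).symm
    rw [h2L, ← Real.rpow_natCast, ← Real.rpow_mul two_pos.le, ← Real.rpow_natCast]
    refine Real.rpow_le_rpow_of_exponent_le one_le_two ?_
    push_cast
    nlinarith
  have hmain : 32 * D * (n : ℝ) ^ a * T ^ (a + 3) ≤ 2 ^ n := by
    refine le_of_sq_le_sq ?_ (by positivity)
    calc (32 * D * (n : ℝ) ^ a * T ^ (a + 3)) ^ 2
        = ((32 * D) ^ 2 * (n : ℝ) ^ (a * 2)) * T ^ ((a + 3) * 2) := by ring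
      _ ≤ 2 ^ n * 2 ^ n := mul_le_mul (hN n hNn) hTn (by positivity) (by positivity)
      _ = (2 ^ n) ^ 2 := by ring
  set P : ℝ := (G.card : ℝ) * ((n : ℝ) + s * a) ^ a with hP
  have hPle : 1 + s * P ≤ D * (n : ℝ) ^ a * T ^ (a + 1) := by
    have h1 : (n : ℝ) + s * a ≤ ((a : ℝ) + 1) * (n * T) := by
      have : (s : ℝ) ≤ n * T := by nlinarith
      have : (n : ℝ) ≤ n * T := by nlinarith
      nlinarith
    have h2 : ((n : ℝ) + s * a) ^ a ≤ (((a : ℝ) + 1) * (n * T)) ^ a :=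
      pow_le_pow_left₀ (by positivity) h1 a
    have h3 : s * P ≤ T * (G.card * (((a : ℝ) + 1) * (n * T)) ^ a) :=
      mul_le_mul hsT (mul_le_mul_of_nonneg_left h2 (by positivity)) (by positivity) hTpos.le
    have h4 : 1 ≤ (n : ℝ) ^ a * T ^ (a + 1) :=
      one_le_mul_of_one_le_of_one_le (one_le_pow₀ hn1) (one_le_pow₀ hT1)
    calc 1 + s * P ≤ (n : ℝ) ^ a * T ^ (a + 1) +
          T * (G.card * (((a : ℝ) + 1) * (n * T)) ^ a) := add_le_add h4 h3
      _ = _ := by rw [hD, mul_pow, mul_pow]; ring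
  have hfin : 1 + s * P ≤ 2 ^ n * ε ^ 2 / 32 := by
    have h1 : 1 ≤ (ε * T) ^ 2 := one_le_pow₀ hεT
    have h2 : 0 ≤ D * (n : ℝ) ^ a * T ^ (a + 1) := by positivity
    calc 1 + s * P ≤ D * (n : ℝ) ^ a * T ^ (a + 1) * 1 := by rw [mul_one]; exact hPle
      _ ≤ D * (n : ℝ) ^ a * T ^ (a + 1) * (ε * T) ^ 2 := mul_le_mul_of_nonneg_left h1 h2
      _ = (32 * D * (n : ℝ) ^ a * T ^ (a + 3)) * ε ^ 2 / 32 := by ring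
      _ ≤ _ := by gcongr
  have hcard : (((G.card * (n + s * a) ^ a + 1) ^ s : ℕ) : ℝ) ≤ Real.exp (s * P) := by
    rw [Real.exp_nat_mul]
    push_cast
    exact pow_le_pow_left₀ (by positivity) (Real.add_one_le_exp _) s
  have h2e : (2 : ℝ) < Real.exp 1 := by linarith [Real.exp_one_gt_d9]
  calc 2 * (((G.card * (n + s * a) ^ a + 1) ^ s : ℕ) : ℝ) *
        Real.exp (-(2 ^ k * (ε / 2) ^ 2 / 4))
      ≤ 2 * Real.exp (s * P) * Real.exp (-(2 ^ k * (ε / 2) ^ 2 / 4)) := by gcongr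
    _ < Real.exp 1 * Real.exp (s * P) * Real.exp (-(2 ^ k * (ε / 2) ^ 2 / 4)) := by gcongr
    _ = Real.exp (1 + s * P - 2 ^ n * ε ^ 2 / 32) := by
      rw [← Real.exp_add, ← Real.exp_add, hnk, pow_succ]
      congr 1
      ring
    _ ≤ 1 := by
      rw [Real.exp_le_one_iff]
      linarith

/-- With `n = k + 1 > C log (s / ε)` qubits there are signs for which the uniform mixture of the
vectors `(|0,j⟩ ± |1,j⟩) / √2` is `(s, ε / 2)`-indistinguishable from the maximally mixed state. -/
def FoolingSigns (G : GateSet) (C : ℝ) : Prop :=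
  ∀ (s : ℕ) (ε : ℝ) (k : ℕ), 0 < s → 0 < ε → ε ≤ 1 / 4 →
    C * Real.logb 2 (s / ε) < (k + 1 : ℕ) →
    ∃ w : QBasis k → Bool, Indist G s (ε / 2)
      (signState w (uniform_mem_stdSimplex (QBasis k))) (maximallyMixed (k + 1))

lemma exists_foolingSigns (G : GateSet) : ∃ C : ℝ, 3 ≤ C ∧ FoolingSigns G C := by
  obtain ⟨C, hC, hbound⟩ := exists_const_union_bound G
  exact ⟨C, hC, fun s ε k hs hε hε1 h => exists_signState_indist G k s (by linarith) (by linarith)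
    (hbound s ε k hs hε hε1 h)⟩

lemma inv_two_pow_le_of_logb_lt {C : ℝ} (hC : 3 ≤ C) {s m : ℕ} {ε : ℝ} (hs : 0 < s) (hε : 0 < ε)
    (hε1 : ε ≤ 1 / 4) (h : C * Real.logb 2 (s / ε) < m) : ((2 : ℝ) ^ m)⁻¹ ≤ ε / 8 := by
  have hL := two_le_logb_div hs hε hε1
  have hs1 : (1 : ℝ) ≤ s := by exact_mod_cast hs
  have h1 : (8 : ℝ) * (s / ε) ≤ 2 ^ m := by
    rw [← Real.rpow_logb two_pos (by norm_num) (show (0 : ℝ) < s / ε by positivity),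
      show (8 : ℝ) = 2 ^ (3 : ℝ) by norm_num, ← Real.rpow_add two_pos, ← Real.rpow_natCast]
    refine Real.rpow_le_rpow_of_exponent_le one_le_two ?_
    nlinarith
  have h2 : 8 / ε ≤ 2 ^ m := by
    refine le_trans ?_ h1
    rw [← mul_div_assoc]
    gcongr
    linarith
  rw [inv_le_comm₀ (by positivity) (by positivity), inv_div]
  exact h2

lemma eventually_eval_le_pow (p : Polynomial ℕ) :
    ∃ d : ℕ, ∀ᶠ κ : ℕ in Filter.atTop, p.eval κ ≤ κ ^ d := by
  refine ⟨p.natDegree + 1, ?_⟩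
  filter_upwards [Filter.eventually_ge_atTop (p.eval 1 + 1)] with κ hκ
  have h1 : 1 ≤ κ := by omega
  have : p.eval κ ≤ p.eval 1 * κ ^ p.natDegree := by
    rw [Polynomial.eval_eq_sum_range, Polynomial.eval_eq_sum_range, Finset.sum_mul]
    refine Finset.sum_le_sum fun i hi => ?_
    rw [one_pow, mul_one]
    exact Nat.mul_le_mul_left _
      (Nat.pow_le_pow_right h1 (Nat.lt_succ_iff.1 (Finset.mem_range.1 hi)))
  rw [pow_succ, mul_comm]
  exact this.trans (Nat.mul_le_mul_right _ (by omega))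

/-- If `n` grows faster than the logarithm, then `2 ^ (c n)` grows faster than any power. -/
lemma eventually_pow_le_two_rpow {n : ℕ → ℕ}
    (hn : (fun κ : ℕ => Real.log κ) =o[Filter.atTop] (fun κ : ℕ => (n κ : ℝ))) {c : ℝ} (hc : 0 < c)
    (d : ℕ) : ∀ᶠ κ : ℕ in Filter.atTop, (κ : ℝ) ^ d ≤ 2 ^ (n κ * c) := by
  have hlog := Real.log_pos one_lt_two
  have hb : 0 < Real.log 2 * c / (d + 1) := by positivity
  filter_upwards [hn.bound hb, Filter.eventually_ge_atTop 1] with κ hκ h1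
  have hκ0 : (0 : ℝ) < κ := by exact_mod_cast h1
  rw [Real.norm_natCast] at hκ
  have hle := (Real.le_norm_self _).trans hκ
  rw [Real.rpow_def_of_pos two_pos, ← Real.log_le_iff_le_exp (by positivity), Real.log_pow]
  rw [div_mul_eq_mul_div, le_div_iff₀ (by positivity)] at hle
  have hl0 : 0 ≤ Real.log κ := Real.log_nonneg (by exact_mod_cast h1)
  linarith

/-! ### The three separations -/

section

variable {n : ℕ} {G : GateSet}

lemma Distinguisher.advantage_comm (A : Distinguisher G n) (ρ σ : QState n) :
    A.advantage ρ σ = A.advantage σ ρ := abs_sub_comm _ _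

lemma Indist.symm {s : ℕ} {ε : ℝ} {ρ σ : QState n} (h : Indist G s ε ρ σ) : Indist G s ε σ ρ :=
  fun A hA => (A.advantage_comm σ ρ).trans_le (h A hA)

lemma exists_dominated_of_relMinEntropy_lt_top {ρ σ : QState n} (h : relMinEntropy ρ σ < ⊤) :
    ∃ c : ℝ, (c • σ.op - ρ.op).PosSemidef := by
  obtain ⟨_, ⟨l, hl, rfl⟩, -⟩ := sInf_lt_iff.1 h
  exact ⟨_, hl⟩

variable {k : ℕ} {δ : ℝ}

lemma one_sub_half_mem (hδ0 : 0 < δ) (hδ1 : δ < 1) : 1 - δ / 2 ∈ Set.Icc (0 : ℝ) 1 :=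
  ⟨by linarith, by linarith⟩

lemma half_mem : (1 / 2 : ℝ) ∈ Set.Icc (0 : ℝ) 1 := by norm_num

lemma two_sub_lt_one_div (hδ0 : 0 < δ) (hδ1 : δ < 1) : 2 - δ < 1 / δ := by
  rw [lt_div_iff₀ hδ0]
  nlinarith

/-- With the bias `1 - δ / 2` the weights of the biased state exceed those of the unbiased one by
a factor of at most `2 - δ < 1 / δ`. -/
lemma denseIn_biasedState (hδ0 : 0 < δ) (hδ1 : δ < 1) {W : QBasis k → ℝ}
    (hW : W ∈ stdSimplex ℝ (QBasis k)) :
    DenseIn δ (biasedState (one_sub_half_mem hδ0 hδ1) hW) (biasedState half_mem hW) := by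
  have h := two_sub_lt_one_div hδ0 hδ1
  have e : (1 / δ) • (biasedState half_mem hW).op -
      (biasedState (one_sub_half_mem hδ0 hδ1) hW).op = Matrix.diagonal fun x =>
        (((1 / δ) * biasedWeights (1 / 2) W x - biasedWeights (1 - δ / 2) W x : ℝ) : ℂ) := by
    rw [biasedState_op, biasedState_op]
    ext x y
    by_cases hxy : x = y <;> simp [hxy]
  rw [DenseIn, e]
  refine Matrix.PosSemidef.diagonal fun x => ?_
  have hW0 := hW.1 (Fin.tail x)
  have : 0 ≤ (1 / δ) * biasedWeights (1 / 2) W x - biasedWeights (1 - δ / 2) W x := by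
    simp only [biasedWeights]
    split_ifs <;> nlinarith
  exact Complex.zero_le_real.2 this

lemma relMinEntropy_biasedState_le (hδ0 : 0 < δ) (hδ1 : δ < 1) :
    relMinEntropy (biasedState (one_sub_half_mem hδ0 hδ1) (uniform_mem_stdSimplex (QBasis k)))
      (maximallyMixed (k + 1)) ≤ (Real.logb 2 (2 - δ) : ℝ) := by
  refine relMinEntropy_le_of_posSemidef ?_
  rw [Real.rpow_logb two_pos (by norm_num) (by linarith), maximallyMixed, biasedState, mixture_op,
    smul_smul, posSemidef_smul_one_sub_iff (by simp) (mul_nonneg (by linarith) (by positivity))]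
  intro x
  have : (0 : ℝ) < ((2 : ℝ) ^ k)⁻¹ := by positivity
  simp only [biasedWeights, Fintype.card_pi, Fintype.card_bool, Finset.prod_const,
    Finset.card_univ, Fintype.card_fin, Nat.cast_pow, Nat.cast_ofNat, pow_succ, mul_inv]
  split_ifs <;> nlinarith

/-- The measurement of the first qubit tells the biased state from every state that has finite
min-entropy relative to a mixture of the vectors `(|0,j⟩ ± |1,j⟩) / √2`. -/
lemma advantage_measureFirst (G : GateSet) (hδ0 : 0 < δ) (hδ1 : δ < 1)
    {w : QBasis k → Bool} {W W' : QBasis k → ℝ} (hW : W ∈ stdSimplex ℝ (QBasis k))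
    (hW' : W' ∈ stdSimplex ℝ (QBasis k)) (c : ℝ) (ρ : QState (k + 1))
    (h : (c • (signState w hW).op - ρ.op).PosSemidef) :
    (measureFirst G k).advantage ρ (biasedState (one_sub_half_mem hδ0 hδ1) hW') =
      (1 - δ) / 2 := by
  rw [Distinguisher.advantage, prob_measureFirst_of_dominated w G hW c ρ h,
    prob_measureFirst_biasedState, abs_of_nonpos (by linarith)]
  ring

end

/-- The witnesses for the failure of the dense model theorem: `ρX` is diagonal with unbiased first
qubit, `ρZ` is `ρX` with its first qubit biased towards `1`, and `ρY` is a mixture of the vectors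
`(|0,j⟩ ± |1,j⟩) / √2` for signs that fool small circuits. The weights are uniform except for one
index `j`, whose larger weight brings the min-entropies to exactly `m₁` and `m₂`; no relation
between `m₁` and `m₂` is needed. -/
lemma not_denseModel (G : GateSet) {C : ℝ} (hC : 3 ≤ C) (hfool : FoolingSigns G C)
    {s : ℕ} {ε δ : ℝ} (hs : 0 < s) (hε : 0 < ε) (hδ0 : 0 < δ) (hδ : δ < 1 - 4 * ε)
    {m₁ m₂ k : ℕ} (h₁ : C * Real.logb 2 (s / ε) < m₁) (h₂ : C * Real.logb 2 (s / ε) < m₂)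
    (hk : m₁ + m₂ = k + 1) :
    ∃ ρX ρY ρZ : QState (k + 1),
      minEntropy ρX = (m₁ : EReal) ∧ minEntropy ρY = (m₂ : EReal) ∧
      DenseIn δ ρZ ρX ∧ Indist G s ε ρX ρY ∧
      ∀ ρM : QState (k + 1), DenseIn δ ρM ρY →
        ∃ A : Distinguisher G (k + 1), A.size ≤ 0 ∧ ε < A.advantage ρM ρZ := by
  have hε1 : ε ≤ 1 / 4 := by linarith
  have hδ1 : δ < 1 := by linarith
  have hp₁ := inv_two_pow_le_of_logb_lt hC hs hε hε1 h₁
  have hp₂ := inv_two_pow_le_of_logb_lt hC hs hε hε1 h₂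
  have hL := two_le_logb_div hs hε hε1
  have hm₁ : 0 < m₁ := by
    have : (0 : ℝ) < m₁ := by nlinarith
    exact_mod_cast this
  have hcard : (Fintype.card (QBasis k) : ℝ) = 2 ^ k := by simp
  obtain ⟨w, hw⟩ := hfool s ε k hs hε hε1 (h₁.trans_le (by exact_mod_cast (by omega)))
  -- each weight on `k` bits is shared by two basis states of `ρX`, whence the factor `2`
  obtain ⟨W₁, hW₁, hle₁, ⟨j₁, hj₁⟩, hlow₁⟩ := exists_weights (ι := QBasis k)
    (a := 2 * ((2 : ℝ) ^ m₁)⁻¹) (by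
      obtain ⟨m, rfl⟩ : ∃ m, m₁ = m + 1 := ⟨m₁ - 1, by omega⟩
      have e : 2 * ((2 : ℝ) ^ (m + 1))⁻¹ = ((2 : ℝ) ^ m)⁻¹ := by
        rw [pow_succ, mul_inv]
        ring
      rw [hcard, e]
      exact inv_anti₀ (by positivity) (pow_le_pow_right₀ one_le_two (by omega))) (by linarith)
  obtain ⟨W₂, hW₂, hle₂, ⟨j₂, hj₂⟩, hlow₂⟩ := exists_weights (ι := QBasis k)
    (a := ((2 : ℝ) ^ m₂)⁻¹) (by
      rw [hcard]
      exact inv_anti₀ (by positivity) (pow_le_pow_right₀ one_le_two (by omega))) (by linarith)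
  refine ⟨biasedState half_mem hW₁, signState w hW₂,
    biasedState (one_sub_half_mem hδ0 hδ1) hW₁, ?_, minEntropy_mixture _ hW₂ hle₂ ⟨j₂, hj₂⟩,
    denseIn_biasedState hδ0 hδ1 hW₁, ?_, ?_⟩
  · refine minEntropy_mixture _ _ (fun x => ?_) ⟨Fin.cons true j₁, ?_⟩
    · have := hle₁ (Fin.tail x)
      simp only [biasedWeights]
      split_ifs <;> linarith
    · simp [biasedWeights, hj₁]
  · intro A hA
    have e1 : |A.prob (biasedState half_mem hW₁) - A.prob (maximallyMixed (k + 1))| ≤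
        2 * ((2 : ℝ) ^ m₁)⁻¹ := by
      rw [← biasedState_half_uniform half_mem]
      refine abs_prob_mixture_sub_le _ A _ _ fun x => ?_
      have := hlow₁ (Fin.tail x)
      simp only [biasedWeights]
      split_ifs <;> linarith
    have e2 : |A.prob (signState w hW₂) -
        A.prob (signState w (uniform_mem_stdSimplex (QBasis k)))| ≤ ((2 : ℝ) ^ m₂)⁻¹ :=
      abs_prob_mixture_sub_le _ A _ _ hlow₂
    have e3 := hw A hA
    rw [Distinguisher.advantage] at e3 ⊢
    rw [abs_le] at e1 e2 e3 ⊢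
    constructor <;> linarith [e1.1, e1.2, e2.1, e2.2, e3.1, e3.2]
  · intro ρM hM
    refine ⟨measureFirst G k, le_rfl, ?_⟩
    rw [advantage_measureFirst G hδ0 hδ1 hW₂ hW₁ _ ρM hM]
    linarith

/-- A state `ρ` close to the maximally mixed state in relative min-entropy, and a state `σ` that
all small circuits confuse with the maximally mixed state, such that states of finite min-entropy
relative to `σ` are told from `ρ` by a measurement. -/
lemma hill_separation (G : GateSet) {k : ℕ} {w : QBasis k → Bool} {δ : ℝ} (hδ0 : 0 < δ)
    (hδ1 : δ < 1) {s : ℕ} {ε : ℝ} (hw : Indist G s ε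
      (signState w (uniform_mem_stdSimplex (QBasis k))) (maximallyMixed (k + 1))) :
    ∃ ρ σ : QState (k + 1), hill2 G s ε ρ σ < (Real.logb 2 (1 / δ) : EReal) ∧
      hill1 G 0 ((1 - δ) / 4) ρ σ = ⊤ := by
  refine ⟨biasedState (one_sub_half_mem hδ0 hδ1) (uniform_mem_stdSimplex (QBasis k)),
    signState w (uniform_mem_stdSimplex (QBasis k)), ?_, ?_⟩
  · have h : hill2 G s ε (biasedState (one_sub_half_mem hδ0 hδ1)
        (uniform_mem_stdSimplex (QBasis k))) (signState w (uniform_mem_stdSimplex (QBasis k))) ≤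
        (Real.logb 2 (2 - δ) : ℝ) :=
      sInf_le ⟨maximallyMixed (k + 1), hw.symm, relMinEntropy_biasedState_le hδ0 hδ1⟩
    refine h.trans_lt (EReal.coe_lt_coe_iff.2 ?_)
    exact Real.logb_lt_logb one_lt_two (by linarith) (two_sub_lt_one_div hδ0 hδ1)
  · refine sInf_eq_top.2 fun l hl => ?_
    obtain ⟨ρ', hind, hle⟩ := hl
    by_contra hl
    obtain ⟨c, hc⟩ :=
      exists_dominated_of_relMinEntropy_lt_top (hle.trans_lt (lt_top_iff_ne_top.2 hl))
    have := hind (measureFirst G k) le_rfl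
    rw [advantage_measureFirst G hδ0 hδ1 (uniform_mem_stdSimplex (QBasis k)) _ c ρ' hc] at this
    linarith

/-- The two states of one term of the ensembles, with circuit size `2 ^ (n / 3C)` and advantage
`2 ^ (-n / 3C)`. -/
lemma exists_ensemble_term (G : GateSet) {C : ℝ} (hC : 3 ≤ C) (hfool : FoolingSigns G C)
    (n : ℕ) :
    ∃ (ρ σ : QState n) (A : Distinguisher G n), relMinEntropy ρ (maximallyMixed n) ≤ 1 ∧
      (6 * C ≤ n → Indist G ⌊(2 : ℝ) ^ (n * (1 / (3 * C)))⌋₊ ((2 : ℝ) ^ (n * (1 / (3 * C))))⁻¹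
        (maximallyMixed n) σ) ∧
      A.size = 0 ∧
      (0 < n → ∀ ρ', relMinEntropy ρ' σ < ⊤ → A.advantage ρ' ρ = 1 / 4) := by
  rcases n with _ | k
  -- without input qubits there is only one state, and the circuit measures an ancilla
  · refine ⟨maximallyMixed 0, maximallyMixed 0, ⟨1, by omega, []⟩, ?_, fun h => ?_, rfl,
      fun h => absurd h (lt_irrefl 0)⟩
    · refine (relMinEntropy_le_of_posSemidef (l := 0) ?_).trans zero_le_one
      simpa using Matrix.PosSemidef.zero
    · norm_num at h
      linarith
  have hw : ∃ w : QBasis k → Bool, 6 * C ≤ (k + 1 : ℕ) →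
      Indist G ⌊(2 : ℝ) ^ ((k + 1 : ℕ) * (1 / (3 * C)))⌋₊
        ((2 : ℝ) ^ ((k + 1 : ℕ) * (1 / (3 * C))))⁻¹
        (maximallyMixed (k + 1)) (signState w (uniform_mem_stdSimplex (QBasis k))) := by
    by_cases hn : 6 * C ≤ (k + 1 : ℕ)
    swap
    · exact ⟨fun _ => false, fun h => absurd h hn⟩
    -- with `s ≤ 2 ^ t` and `ε = 2 ^ (-t)` the required number of qubits is at most
    -- `2 * C * t = 2 * n / 3`
    set t : ℝ := (k + 1 : ℕ) * (1 / (3 * C)) with ht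
    have ht2 : 2 ≤ t := by
      rw [ht, mul_one_div, le_div_iff₀ (by linarith)]
      linarith
    have h4 : (4 : ℝ) ≤ 2 ^ t := by
      calc (4 : ℝ) = 2 ^ (2 : ℝ) := by norm_num
        _ ≤ 2 ^ t := Real.rpow_le_rpow_of_exponent_le one_le_two ht2
    have hs : 0 < ⌊(2 : ℝ) ^ t⌋₊ := Nat.floor_pos.2 (by linarith)
    have hs' : (0 : ℝ) < (⌊(2 : ℝ) ^ t⌋₊ : ℝ) := by exact_mod_cast hs
    have hε : 0 < ((2 : ℝ) ^ t)⁻¹ := by positivity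
    have hlog : Real.logb 2 ((⌊(2 : ℝ) ^ t⌋₊ : ℝ) / ((2 : ℝ) ^ t)⁻¹) ≤ 2 * t := by
      rw [Real.logb_le_iff_le_rpow one_lt_two (by positivity), div_inv_eq_mul, two_mul,
        Real.rpow_add two_pos]
      exact mul_le_mul_of_nonneg_right (Nat.floor_le (by positivity)) (by positivity)
    obtain ⟨w, hw⟩ := hfool _ _ k hs hε (by
      rw [one_div]
      exact inv_anti₀ (by norm_num) h4) (by
      have e : C * (2 * t) = 2 / 3 * (k + 1 : ℕ) := by
        rw [ht]
        field_simp
      have := mul_le_mul_of_nonneg_left hlog (show 0 ≤ C by linarith)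
      have hk : (0 : ℝ) < (k + 1 : ℕ) := by positivity
      linarith)
    exact ⟨w, fun _ A hA => (hw.symm A hA).trans (by linarith)⟩
  obtain ⟨w, hw⟩ := hw
  have hδ0 : (0 : ℝ) < 1 / 2 := by norm_num
  have hδ1 : (1 / 2 : ℝ) < 1 := by norm_num
  refine ⟨biasedState (one_sub_half_mem hδ0 hδ1) (uniform_mem_stdSimplex (QBasis k)),
    signState w (uniform_mem_stdSimplex (QBasis k)), measureFirst G k, ?_, hw, rfl,
    fun _ ρ' hρ' => ?_⟩
  · refine (relMinEntropy_biasedState_le hδ0 hδ1).trans ?_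
    rw [← EReal.coe_one, EReal.coe_le_coe_iff, Real.logb_le_iff_le_rpow one_lt_two (by norm_num)]
    norm_num
  · obtain ⟨c, hc⟩ := exists_dominated_of_relMinEntropy_lt_top hρ'
    rw [advantage_measureFirst G hδ0 hδ1 (uniform_mem_stdSimplex (QBasis k)) _ c ρ' hc]
    norm_num

/-- Indistinguishability with size `2 ^ (c n)` and advantage `2 ^ (-c n)` is computational
indistinguishability, since these bounds are superpolynomial when `n` grows faster than the
logarithm. -/
lemma compIndist_of_indist {G : GateSet} {n : ℕ → ℕ}
    (hn : (fun κ : ℕ => Real.log κ) =o[Filter.atTop] (fun κ : ℕ => (n κ : ℝ))) {c : ℝ} (hc : 0 < c)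
    {ρ σ : ∀ κ, QState (n κ)} (h : ∀ᶠ κ in Filter.atTop,
      Indist G ⌊(2 : ℝ) ^ (n κ * c)⌋₊ ((2 : ℝ) ^ (n κ * c))⁻¹ (ρ κ) (σ κ)) :
    CompIndist G ρ σ := by
  intro p A hA d
  obtain ⟨e, he⟩ := eventually_eval_le_pow p
  refine squeeze_zero' (g := fun κ : ℕ => ((κ : ℝ))⁻¹)
    (Filter.Eventually.of_forall fun κ => mul_nonneg (by positivity) (abs_nonneg _)) ?_
    tendsto_inv_atTop_nhds_zero_nat
  filter_upwards [h, he, eventually_pow_le_two_rpow hn hc e,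
    eventually_pow_le_two_rpow hn hc (d + 1), Filter.eventually_gt_atTop 0] with κ h1 h2 h3 h4 h5
  have hκ : (0 : ℝ) < κ := by exact_mod_cast h5
  have hsize : (A κ).size ≤ ⌊(2 : ℝ) ^ (n κ * c)⌋₊ := by
    refine Nat.le_floor (le_trans ?_ h3)
    exact_mod_cast (hA κ).trans h2
  refine (mul_le_mul_of_nonneg_left (h1 _ hsize) (by positivity)).trans ?_
  rw [← div_eq_mul_inv, div_le_iff₀ (by positivity), inv_mul_eq_div, le_div_iff₀ hκ, ← pow_succ]
  exact h4

end

theorem mainTheorem4 (G : GateSet) :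
    -- impossibility of a quantum dense model theorem
    (∃ (C : ℝ) (c : ℕ), 0 < C ∧
      ∀ (s : ℕ) (ε δ : ℝ), 0 < s → 0 < ε → 0 < δ → δ < 1 - 4 * ε →
      ∀ m₁ m₂ : ℕ, C * Real.logb 2 (s / ε) < m₁ → C * Real.logb 2 (s / ε) < m₂ →
      ∃ ρX ρY ρZ : QState (m₁ + m₂),
        minEntropy ρX = (m₁ : EReal) ∧ minEntropy ρY = (m₂ : EReal) ∧
        DenseIn δ ρZ ρX ∧
        Indist G s ε ρX ρY ∧
        ∀ ρM : QState (m₁ + m₂), DenseIn δ ρM ρY →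
          ∃ A : Distinguisher G (m₁ + m₂), A.size ≤ c ∧ ε < A.advantage ρM ρZ) ∧
    -- separation of the two HILL relative min-entropies, concrete version
    (∃ (C : ℝ) (c : ℕ), 0 < C ∧
      ∀ (s : ℕ) (ε δ : ℝ), 0 < s → 0 < ε → 0 < δ → δ < 1 - 4 * ε →
      ∀ n : ℕ, C * Real.logb 2 (s / ε) < n →
      ∃ ρ σ : QState n,
        hill2 G s ε ρ σ < (Real.logb 2 (1 / δ) : EReal) ∧
        hill1 G c ((1 - δ) / 4) ρ σ = ⊤) ∧
    -- separation of the two HILL relative min-entropies, asymptotic version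
    (∀ n : ℕ → ℕ, (fun κ : ℕ => Real.log κ) =o[Filter.atTop] (fun κ : ℕ => (n κ : ℝ)) →
      ∃ ρ σ : ∀ κ, QState (n κ),
        AsympHILL2LE G ρ σ (fun _ => 1) ∧
        ∀ l : ℕ → EReal, (∃ᶠ κ in Filter.atTop, l κ < ⊤) → ¬ AsympHILL1LE G ρ σ l) := by
  obtain ⟨C, hC, hfool⟩ := exists_foolingSigns G
  have hpos : ∀ {s n : ℕ} {ε : ℝ}, 0 < s → 0 < ε → ε ≤ 1 / 4 → C * Real.logb 2 (s / ε) < n →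
      ∃ k, n = k + 1 := by
    intro s n ε hs hε hε1 h
    have := two_le_logb_div hs hε hε1
    have h0 : (0 : ℝ) < n := by nlinarith
    exact Nat.exists_eq_succ_of_ne_zero (by exact_mod_cast h0.ne')
  refine ⟨⟨C, 0, by linarith, ?_⟩, ⟨C, 0, by linarith, ?_⟩, ?_⟩
  · intro s ε δ hs hε hδ0 hδ m₁ m₂ h₁ h₂
    obtain ⟨k, hk⟩ := hpos (n := m₁ + m₂) hs hε (by linarith)
      (h₁.trans_le (by exact_mod_cast Nat.le_add_right _ _))
    have := not_denseModel G hC hfool hs hε hδ0 hδ h₁ h₂ hk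
    rwa [← hk] at this
  · intro s ε δ hs hε hδ0 hδ n hn
    obtain ⟨k, rfl⟩ := hpos hs hε (by linarith) hn
    obtain ⟨w, hw⟩ := hfool s ε k hs hε (by linarith) hn
    exact hill_separation G hδ0 (by linarith) fun A hA => (hw A hA).trans (by linarith)
  · intro n hn
    choose ρ σ A hρ hσ hA hadv using fun κ => exists_ensemble_term G hC hfool (n κ)
    have hlarge : ∀ B : ℝ, ∀ᶠ κ in Filter.atTop, B ≤ n κ := by
      intro B
      filter_upwards [hn.bound one_pos, (Real.tendsto_log_atTop.comp
        tendsto_natCast_atTop_atTop).eventually_ge_atTop B] with κ h1 h2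
      rw [one_mul, Real.norm_natCast] at h1
      exact h2.trans ((Real.le_norm_self _).trans h1)
    refine ⟨ρ, σ, ⟨fun κ => maximallyMixed (n κ), ?_, hρ⟩, ?_⟩
    · refine compIndist_of_indist hn (c := 1 / (3 * C)) (by positivity) ?_
      filter_upwards [hlarge (6 * C)] with κ hκ using hσ κ hκ
    · rintro l hl ⟨ρ', hind, hle⟩
      have h0 := hind 0 A (fun κ => by simp [hA]) 0
      simp only [pow_zero, one_mul] at h0
      obtain ⟨κ, h1, h2, h3⟩ := (hl.and_eventually ((h0.eventually_lt_const
        (show (0 : ℝ) < 1 / 4 by norm_num)).and (hlarge 1))).exists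
      rw [hadv κ (by exact_mod_cast (by linarith : (0 : ℝ) < n κ)) _ ((hle κ).trans_lt h1)] at h2
      exact lt_irrefl _ h2
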